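/- Let $b=(b_k)_{k\ge1}\in\ell^2(\mathbb R)$ with $b_k\neq0$ for all $k$, and let $\omega=(\omega_k)_{k\ge1}$ be real numbers with $\omega_1>0$ and $\omega_{k+1}-\omega_k\ge\omega_*>0$ for all $k\ge1$. On the Hilbert space $H=\ell^2(\mathbb R)\times\ell^2(\mathbb R)$ consider the system of controlled oscillators $$\dot\xi_k=\omega_k\eta_k,\qquad \dot\eta_k=-\omega_k\xi_k+b_ku(t),\qquad k\ge1,$$ written as $\dot x=Ax+Bu$ with $x=(\xi,\eta)$, $A(\xi,\eta)=(\Omega\eta,-\Omega\xi)$, $\Omega=\mathrm{diag}(\omega_1,\omega_2,\dots)$, $B=(0,b)$. Here $A$ generates a unitary group $(e^{tA})_{t\in\mathbb R}$ on $H$, and the solution with initial state $x^0\in H$ and scalar control $u\in L^2(0,T)$ is $x(t)=e^{tA}x^0+\int_0^te^{(t-s)A}Bu(s)\,ds$. Let $\mathcal R_T(x^0)=\{x(T): u\in L^2(0,T)\}$ be the reachable set, and let $$V_{0,1}=\Big\{(\xi,\eta):\ \sum_{k\ge1}\frac{\xi_k^2+\eta_k^2}{|b_k|^2}<\infty\Big\}\subset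 H,\qquad \big\langle(\xi,\eta),(\tilde\xi,\tilde\eta)\big\rangle_{V_{0,1}}=\sum_{k\ge1}\frac{\xi_k\tilde\xi_k+\eta_k\tilde\eta_k}{|b_k|^2}.$$ The system is called exactly controllable in time $T$ in a linear subspace $W\subset H$ if for all $x^0,x^1\in W$ there is $u\in L^2(0,T)$ such that the solution with $x(0)=x^0$ satisfies $x(T)=x^1$. A Hilbert subspace of $H$ is a linear subspace of $H$ endowed with an inner product for which it is a Hilbert space continuously embedded in $H$. Let $T>2\pi/\omega_*$. Then: 1. $V_{0,1}$, with the inner product above, is a Hilbert subspace of $H$, and the system is exactly controllable in time $T$ in $V_{0,1}$. 2. $\mathcal R_T(x^0)=V_{0,1}$ for every $x^0\in V_{0,1}$. 3. $V_{0,1}$ is the largest Hilbert subspace of $H$ in which the system is exactly controllable in time $T$: every such Hilbert subspace is contained in $V_{0,1}$. 4. The system is well posed in $V_{0,1}$: for every $\tau>0$ there is a constant $C$ such that, for all $x^0\in V_{0,1}$ and $u\in L^2(0,\tau)$, the solution $x$ with $x(0)=x^0$ satisfies $x(t)\in V_{0,1}$ for all $t\in[0,\tau]$, $x\in C^0([0,\tau];V_{0,1})$,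 and $\|x(t)\|_{V_{0,1}}\le C\big(\|x^0\|_{V_{0,1}}+\|u\|_{L^2(0,\tau)}\big)$ for all $t\in[0,\tau]$. -/

import Mathlib

open MeasureTheory Filter Topology Set

namespace Oscillator

/-- The real Hilbert space `ℓ²(ℝ)`, indexed by `ℕ = {0, 1, 2, …}`. -/
abbrev EllTwo : Type := lp (fun _ : ℕ => ℝ) 2

/-- The state space `H = ℓ²(ℝ) × ℓ²(ℝ)` with its Hilbert norm; a state is `x = (ξ, η)`,
with `ξ = x.fst` and `η = x.snd`. -/
abbrev State : Type := WithLp 2 (EllTwo × EllTwo)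

theorem summable_sq (ξ : EllTwo) : Summable fun k => ξ k ^ 2 := by
  simpa using lp.memℓp ξ |>.summable (by norm_num)

theorem memℓp_two_of_sq_le {f g : ℕ → ℝ} (hg : Summable g) (hfg : ∀ k, f k ^ 2 ≤ g k) :
    Memℓp f 2 := by
  refine memℓp_gen ?_
  simpa using Summable.of_nonneg_of_le (fun k => sq_nonneg (f k)) hfg hg

theorem memℓp_rot (c s : ℕ → ℝ) (hcs : ∀ k, c k ^ 2 + s k ^ 2 = 1) (ξ η : EllTwo) :
    Memℓp (fun k => c k * ξ k + s k * η k) 2 :=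
  memℓp_two_of_sq_le ((summable_sq ξ).add (summable_sq η)) fun k => by
    nlinarith [sq_nonneg (s k * ξ k - c k * η k), hcs k,
      congrArg (fun z => z * (ξ k ^ 2 + η k ^ 2)) (hcs k)]

/-- The graph of the operator `A = [[0, Ω], [-Ω, 0]]`, `Ω = diag(ω₀, ω₁, …)`, on its domain
`D(A) = {x ∈ H | A x ∈ H}`. -/
def GenGraph (ω : ℕ → ℝ) (x y : State) : Prop :=
  ∀ k, y.fst k = ω k * x.snd k ∧ y.snd k = -ω k * x.fst k

/-- The unitary group `e^{tA}`: a rotation in every mode. -/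
noncomputable def flow (ω : ℕ → ℝ) (t : ℝ) (x : State) : State :=
  WithLp.toLp 2
    (⟨fun k => Real.cos (ω k * t) * x.fst k + Real.sin (ω k * t) * x.snd k,
      memℓp_rot _ _ (fun k => Real.cos_sq_add_sin_sq (ω k * t)) x.fst x.snd⟩,
     ⟨fun k => -Real.sin (ω k * t) * x.fst k + Real.cos (ω k * t) * x.snd k,
      memℓp_rot _ _ (fun k => by rw [neg_sq]; exact Real.sin_sq_add_cos_sq (ω k * t))
        x.fst x.snd⟩)

@[simp] theorem flow_fst (ω : ℕ → ℝ) (t : ℝ) (x : State) (k : ℕ) :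
    (flow ω t x).fst k = Real.cos (ω k * t) * x.fst k + Real.sin (ω k * t) * x.snd k := rfl

@[simp] theorem flow_snd (ω : ℕ → ℝ) (t : ℝ) (x : State) (k : ℕ) :
    (flow ω t x).snd k = -Real.sin (ω k * t) * x.fst k + Real.cos (ω k * t) * x.snd k := rfl

theorem state_ext {x y : State} (h : ∀ k, x.fst k = y.fst k ∧ x.snd k = y.snd k) : x = y := by
  apply WithLp.ofLp_injective
  exact Prod.ext (lp.ext (funext fun k => (h k).1)) (lp.ext (funext fun k => (h k).2))

theorem flow_zero (ω : ℕ → ℝ) (x : State) : flow ω 0 x = x :=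
  state_ext fun k => by simp

theorem flow_add (ω : ℕ → ℝ) (s t : ℝ) (x : State) :
    flow ω (s + t) x = flow ω s (flow ω t x) :=
  state_ext fun k => by
    simp only [flow_fst, flow_snd, mul_add, Real.cos_add, Real.sin_add]
    constructor <;> ring

theorem tendsto_ellTwo {l : Filter ℝ} {F : ℝ → EllTwo} {G : EllTwo} {g : ℕ → ℝ}
    (hg : Summable g) (hb : ∀ h k, (F h k - G k) ^ 2 ≤ g k)
    (hF : ∀ k, Tendsto (fun h => F h k) l (𝓝 (G k))) : Tendsto F l (𝓝 G) := by
  rw [tendsto_iff_norm_sub_tendsto_zero]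
  have h1 : ∀ h, ‖F h - G‖ = Real.sqrt (∑' k, (F h k - G k) ^ 2) := fun h => by
    rw [lp.norm_eq_tsum_rpow (by norm_num), Real.sqrt_eq_rpow]
    simp
  have h2 : Tendsto (fun h => ∑' k, (F h k - G k) ^ 2) l (𝓝 (∑' _ : ℕ, (0 : ℝ))) :=
    tendsto_tsum_of_dominated_convergence hg
      (fun k => by simpa using ((hF k).sub_const (G k)).pow 2)
      (Eventually.of_forall fun h k => by
        rw [Real.norm_of_nonneg (sq_nonneg _)]; exact hb h k)
  simp only [h1]
  simpa using h2.sqrt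

theorem tendsto_state {l : Filter ℝ} {F : ℝ → State} {G : State} {g : ℕ → ℝ}
    (hg : Summable g)
    (hb : ∀ h k, ((F h).fst k - G.fst k) ^ 2 ≤ g k ∧ ((F h).snd k - G.snd k) ^ 2 ≤ g k)
    (hF : ∀ k, Tendsto (fun h => (F h).fst k) l (𝓝 (G.fst k)) ∧
      Tendsto (fun h => (F h).snd k) l (𝓝 (G.snd k))) : Tendsto F l (𝓝 G) :=
  ((WithLp.prod_continuous_toLp 2 EllTwo EllTwo).tendsto (WithLp.ofLp G)).comp
    ((tendsto_ellTwo hg (fun h k => (hb h k).1) fun k => (hF k).1).prodMk_nhds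
      (tendsto_ellTwo hg (fun h k => (hb h k).2) fun k => (hF k).2))

/-- `A` is the infinitesimal generator of the group `flow ω`. -/
theorem genGraph_iff_hasDerivAt (ω : ℕ → ℝ) (x y : State) :
    GenGraph ω x y ↔ HasDerivAt (fun t => flow ω t x) y 0 := by
  have hc : ∀ k, HasDerivAt (fun t => (flow ω t x).fst k) (ω k * x.snd k) 0 ∧
      HasDerivAt (fun t => (flow ω t x).snd k) (-ω k * x.fst k) 0 := fun k => by
    have h0 : HasDerivAt (fun t : ℝ => ω k * t) (ω k) 0 := by
      simpa using (hasDerivAt_id (0 : ℝ)).const_mul (ω k)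
    constructor
    · refine ((h0.cos.mul_const (x.fst k)).add (h0.sin.mul_const (x.snd k))).congr_deriv ?_
      simp
    · refine ((h0.sin.fun_neg.mul_const (x.fst k)).add (h0.cos.mul_const (x.snd k))).congr_deriv ?_
      simp
  constructor
  · intro hA
    rw [hasDerivAt_iff_tendsto_slope]
    refine tendsto_state (g := fun k => 8 * (y.fst k ^ 2 + y.snd k ^ 2))
      (((summable_sq y.fst).add (summable_sq y.snd)).mul_left 8) ?_ ?_
    · intro h k
      have hs : (slope (fun t => flow ω t x) 0 h).fst k =
            h⁻¹ * (Real.cos (ω k * h) - 1) * x.fst k + h⁻¹ * Real.sin (ω k * h) * x.snd k ∧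
          (slope (fun t => flow ω t x) 0 h).snd k =
            -(h⁻¹ * Real.sin (ω k * h)) * x.fst k + h⁻¹ * (Real.cos (ω k * h) - 1) * x.snd k := by
        have e1 : (slope (fun t => flow ω t x) 0 h).fst k =
          (h - 0)⁻¹ * ((flow ω h x).fst k - (flow ω 0 x).fst k) := rfl
        have e2 : (slope (fun t => flow ω t x) 0 h).snd k =
          (h - 0)⁻¹ * ((flow ω h x).snd k - (flow ω 0 x).snd k) := rfl
        rw [e1, e2, flow_zero, flow_fst, flow_snd, sub_zero]
        constructor <;> ring
      have hq : (h⁻¹ * (Real.cos (ω k * h) - 1)) ^ 2 + (h⁻¹ * Real.sin (ω k * h)) ^ 2 ≤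
          ω k ^ 2 := by
        have e : (h⁻¹ * (Real.cos (ω k * h) - 1)) ^ 2 + (h⁻¹ * Real.sin (ω k * h)) ^ 2 =
            h⁻¹ ^ 2 * (2 - 2 * Real.cos (ω k * h)) := by
          linear_combination h⁻¹ ^ 2 * Real.sin_sq_add_cos_sq (ω k * h)
        rw [e]
        rcases eq_or_ne h 0 with rfl | hh
        · simpa using sq_nonneg (ω k)
        · calc h⁻¹ ^ 2 * (2 - 2 * Real.cos (ω k * h)) ≤ h⁻¹ ^ 2 * (ω k * h) ^ 2 := by
                gcongr
                linarith [Real.one_sub_sq_div_two_le_cos (x := ω k * h)]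
            _ = ω k ^ 2 := by field_simp
      rw [hs.1, hs.2, (hA k).1, (hA k).2]
      generalize h⁻¹ * (Real.cos (ω k * h) - 1) = a at hq
      generalize h⁻¹ * Real.sin (ω k * h) = c at hq
      have hm := mul_le_mul_of_nonneg_right hq
        (add_nonneg (sq_nonneg (x.fst k)) (sq_nonneg (x.snd k)))
      constructor
      · nlinarith [sq_nonneg (c * x.fst k - a * x.snd k),
          sq_nonneg (a * x.fst k + c * x.snd k + ω k * x.snd k),
          sq_nonneg (ω k * x.fst k), sq_nonneg (ω k * x.snd k)]
      · nlinarith [sq_nonneg (a * x.fst k + c * x.snd k),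
          sq_nonneg (-c * x.fst k + a * x.snd k - ω k * x.fst k),
          sq_nonneg (ω k * x.fst k), sq_nonneg (ω k * x.snd k)]
    · intro k
      rw [(hA k).1, (hA k).2]
      exact ⟨hasDerivAt_iff_tendsto_slope.1 (hc k).1, hasDerivAt_iff_tendsto_slope.1 (hc k).2⟩
  · intro h k
    have h1 := ((lp.evalCLM ℝ (fun _ : ℕ => ℝ) 2 k).comp
      (WithLp.fstL 2 ℝ EllTwo EllTwo)).hasFDerivAt.comp_hasDerivAt (0 : ℝ) h
    have h2 := ((lp.evalCLM ℝ (fun _ : ℕ => ℝ) 2 k).comp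
      (WithLp.sndL 2 ℝ EllTwo EllTwo)).hasFDerivAt.comp_hasDerivAt (0 : ℝ) h
    exact ⟨h1.unique (hc k).1, h2.unique (hc k).2⟩

/-- The group `flow ω` is strongly continuous. -/
theorem continuous_flow (ω : ℕ → ℝ) (x : State) : Continuous fun t => flow ω t x := by
  refine continuous_iff_continuousAt.2 fun t => ?_
  refine tendsto_state (g := fun k => 16 * (x.fst k ^ 2 + x.snd k ^ 2))
    (((summable_sq x.fst).add (summable_sq x.snd)).mul_left 16) ?_ ?_
  · intro h k
    simp only [flow_fst, flow_snd]
    have key : ∀ c s c' s' p q : ℝ, s ^ 2 + c ^ 2 = 1 → s' ^ 2 + c' ^ 2 = 1 →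
        (c * p + s * q - (c' * p + s' * q)) ^ 2 ≤ 16 * (p ^ 2 + q ^ 2) := by
      intro c s c' s' p q h1 h2
      have h3 : (c - c') ^ 2 + (s - s') ^ 2 ≤ 16 := by
        nlinarith [sq_nonneg (c + c'), sq_nonneg (s + s')]
      nlinarith [mul_le_mul_of_nonneg_right h3 (add_nonneg (sq_nonneg p) (sq_nonneg q)),
        sq_nonneg ((s - s') * p - (c - c') * q)]
    exact ⟨key _ _ _ _ _ _ (Real.sin_sq_add_cos_sq _) (Real.sin_sq_add_cos_sq _),
      key _ _ _ _ _ _ (by rw [neg_sq]; exact Real.cos_sq_add_sin_sq _)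
        (by rw [neg_sq]; exact Real.cos_sq_add_sin_sq _)⟩
  · intro k
    have h1 : Continuous fun h => (flow ω h x).fst k := by simp only [flow_fst]; fun_prop
    have h2 : Continuous fun h => (flow ω h x).snd k := by simp only [flow_snd]; fun_prop
    exact ⟨h1.tendsto t, h2.tendsto t⟩

/-- The control vector `B = (0, b)`. -/
noncomputable def ctrl (b : EllTwo) : State := WithLp.toLp 2 (0, b)

/-- `u ∈ L²(0, T)`. -/
def IsControl (T : ℝ) (u : ℝ → ℝ) : Prop := MemLp u 2 (volume.restrict (Ioc 0 T))

/-- The solution `x(t) = e^{tA} x⁰ + ∫₀ᵗ e^{(t-s)A} B u(s) ds` of `ẋ = A x + B u`,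
`x(0) = x⁰`. -/
noncomputable def solution (ω : ℕ → ℝ) (b : EllTwo) (x₀ : State) (u : ℝ → ℝ) (t : ℝ) : State :=
  flow ω t x₀ + ∫ s in (0 : ℝ)..t, u s • flow ω (t - s) (ctrl b)

/-- The reachable set `R_T(x⁰)`. -/
def reachable (ω : ℕ → ℝ) (b : EllTwo) (T : ℝ) (x₀ : State) : Set State :=
  {x | ∃ u, IsControl T u ∧ solution ω b x₀ u T = x}

/-- The inner product of `V_{0,1}`. -/
noncomputable def vInner (b : EllTwo) (x y : State) : ℝ :=
  ∑' k, (x.fst k * y.fst k + x.snd k * y.snd k) / |b k| ^ 2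

/-- The norm of `V_{0,1}`. -/
noncomputable def vNorm (b : EllTwo) (x : State) : ℝ := Real.sqrt (vInner b x x)

/-- The space `V_{0,1}` of all `(ξ, η)` with `∑ (ξₖ² + ηₖ²) / |bₖ|² < ∞`. -/
def V (b : EllTwo) : Submodule ℝ State where
  carrier := {x | Summable fun k => (x.fst k ^ 2 + x.snd k ^ 2) / |b k| ^ 2}
  zero_mem' := by simp
  add_mem' := by
    intro x y hx hy
    refine Summable.of_nonneg_of_le (fun k => by positivity) (fun k => ?_)
      ((hx.add hy).mul_left 2)
    have h : (x + y).fst k = x.fst k + y.fst k ∧ (x + y).snd k = x.snd k + y.snd k := ⟨rfl, rfl⟩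
    rw [h.1, h.2, ← add_div, ← mul_div_assoc]
    gcongr
    nlinarith [sq_nonneg (x.fst k - y.fst k), sq_nonneg (x.snd k - y.snd k)]
  smul_mem' := by
    intro c x hx
    refine (hx.mul_left (c ^ 2)).congr fun k => ?_
    have h : (c • x).fst k = c * x.fst k ∧ (c • x).snd k = c * x.snd k := ⟨rfl, rfl⟩
    rw [h.1, h.2]
    ring

/-- Every pair of sequences with `∑ (ξₖ² + ηₖ²) / |bₖ|² < ∞` lies in `H`, so nothing is lost by
defining `V_{0,1}` inside `H`. -/
theorem memℓp_of_summable (b : EllTwo) (hb : ∀ k, b k ≠ 0) (ξ η : ℕ → ℝ)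
    (h : Summable fun k => (ξ k ^ 2 + η k ^ 2) / |b k| ^ 2) : Memℓp ξ 2 ∧ Memℓp η 2 := by
  have key : ∀ k, ξ k ^ 2 + η k ^ 2 ≤ ‖b‖ ^ 2 * ((ξ k ^ 2 + η k ^ 2) / |b k| ^ 2) := fun k => by
    have h1 : |b k| ≤ ‖b‖ := lp.norm_apply_le_norm (by norm_num) b k
    have h2 : 0 < |b k| := abs_pos.2 (hb k)
    rw [← mul_div_assoc, le_div_iff₀ (by positivity), mul_comm]
    gcongr
  exact ⟨memℓp_two_of_sq_le (h.mul_left (‖b‖ ^ 2)) fun k => by nlinarith [key k, sq_nonneg (η k)],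
    memℓp_two_of_sq_le (h.mul_left (‖b‖ ^ 2)) fun k => by nlinarith [key k, sq_nonneg (ξ k)]⟩

/-- The linear subspace `W` of `H`, equipped with `ip`, is a Hilbert space that is continuously
embedded in `H`: it is the image of a Hilbert space `E` under an injective bounded operator that
carries the inner product of `E` to `ip`. -/
def IsHilbertSubspaceWith (W : Submodule ℝ State) (ip : State → State → ℝ) : Prop :=
  ∃ (E : Type) (_ : NormedAddCommGroup E) (_ : InnerProductSpace ℝ E) (_ : CompleteSpace E)
    (ι : E →L[ℝ] State), Function.Injective ι ∧ Set.range ι = (W : Set State) ∧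
      ∀ x y : E, inner ℝ x y = ip (ι x) (ι y)

/-- `W` is a Hilbert subspace of `H`, for some inner product of its own. -/
def IsHilbertSubspace (W : Submodule ℝ State) : Prop := ∃ ip, IsHilbertSubspaceWith W ip

/-- Exact controllability in `W` in time `T`: every point of `W` can be steered to every point of
`W` in time `T` by an `L²` control. -/
def ExactlyControllableIn (ω : ℕ → ℝ) (b : EllTwo) (T : ℝ) (W : Submodule ℝ State) : Prop :=
  ∀ x₀ ∈ W, ∀ x₁ ∈ W, ∃ u, IsControl T u ∧ solution ω b x₀ u T = x₁

/-- Well-posedness (admissibility) in `V_{0,1}`: on every interval `[0, τ]`, a solution that starts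
in `V_{0,1}` stays in `V_{0,1}`, is continuous with values in `V_{0,1}`, and depends continuously on
the initial state and on the control. -/
def WellPosedInV (ω : ℕ → ℝ) (b : EllTwo) : Prop :=
  ∀ τ > 0, ∃ C : ℝ, ∀ x₀ ∈ V b, ∀ u, IsControl τ u →
    (∀ t ∈ Icc 0 τ, solution ω b x₀ u t ∈ V b) ∧
    (∀ t ∈ Icc 0 τ, Tendsto
      (fun s => vNorm b (solution ω b x₀ u s - solution ω b x₀ u t)) (𝓝[Icc 0 τ] t) (𝓝 0)) ∧
    (∀ t ∈ Icc 0 τ, vNorm b (solution ω b x₀ u t) ≤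
      C * (vNorm b x₀ + Real.sqrt (∫ s in (0 : ℝ)..τ, u s ^ 2)))

end Oscillator

/-!
In the coordinates `zₖ = (ηₖ + i ξₖ) / bₖ`, which identify `V_{0,1}` isometrically with `H`, the
group acts by `zₖ ↦ e^{i ωₖ t} zₖ`, and a control `u` adds its moment `∫₀ᵗ e^{-i ωₖ s} u(s) ds` to
the `k`-th coordinate of `e^{-tA} x(t)`. Everything thus reduces to two-sided bounds between
`∫ |∑ aₖ e^{i νₖ t}|² dt` and `∑ |aₖ|²`: by duality the upper bound makes the moments of an `L²`
control square summable, which is well-posedness, and the lower bound makes every square summable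
sequence a sequence of moments, which is controllability.

For separated frequencies both bounds are Ingham's inequality, proved by weighting `|f|²` with a
positive arch of a cosine, whose Fourier transform decays quadratically, so that the off-diagonal
terms sum to a telescoping series. A real control needs the frequencies `±ωₖ` together, and only
the gap between `ω₀` and `-ω₀` may be smaller than `ω_*`. Following Haraux, the single frequency
`μ = -ω₀` is removed by passing from `f` to `f(t) - (2δ)⁻¹ ∫_{-δ}^{δ} e^{-iμs} f(t + s) ds`, at the
price of an arbitrarily small extension of the interval, and its coefficient is recovered
afterwards from the bounds on the others.
-/

namespace Oscillator

open ComplexConjugate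

/-! ### Exponential sums and Ingham inequalities -/

section ExpSum

variable {ι : Type*}

/-- The exponential sum `t ↦ ∑ i ∈ F, aᵢ e^{i νᵢ t}` with frequencies `ν` and coefficients `a`. -/
noncomputable def expSum (ν : ι → ℝ) (F : Finset ι) (a : ι → ℂ) (t : ℝ) : ℂ :=
  ∑ i ∈ F, a i * Complex.exp ((ν i * t : ℝ) * Complex.I)

theorem continuous_expSum (ν : ι → ℝ) (F : Finset ι) (a : ι → ℂ) : Continuous (expSum ν F a) := by
  unfold expSum
  fun_prop

/-- The cosine-windowed Fourier integral `∫_{-R}^{R} cos(αt) e^{ilt} dt`. -/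
noncomputable def cosTransform (α R l : ℝ) : ℂ :=
  ∫ t in -R..R, (Real.cos (α * t) : ℂ) * Complex.exp ((l * t : ℝ) * Complex.I)

theorem cosTransform_eq {α R l : ℝ} (hαR : α * R = Real.pi / 2) (hl : α ^ 2 - l ^ 2 ≠ 0) :
    cosTransform α R l = (2 * α * Real.cos (l * R) / (α ^ 2 - l ^ 2) : ℝ) := by
  have hderiv : ∀ t : ℝ, HasDerivAt (fun t : ℝ => Complex.exp ((l * t : ℝ) * Complex.I) *
      (α * Real.sin (α * t) + l * Complex.I * Real.cos (α * t)) / (α ^ 2 - l ^ 2 : ℝ))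
      (Real.cos (α * t) * Complex.exp ((l * t : ℝ) * Complex.I)) t := fun t => by
    have hexp : HasDerivAt (fun t : ℝ => Complex.exp ((l * t : ℝ) * Complex.I))
        (Complex.exp ((l * t : ℝ) * Complex.I) * ((l : ℝ) * Complex.I)) t := by
      simpa using ((((hasDerivAt_id t).const_mul l).ofReal_comp).mul_const Complex.I).cexp
    have hαt : HasDerivAt (fun t : ℝ => α * t) α t := by
      simpa using (hasDerivAt_id t).const_mul α
    refine ((hexp.fun_mul ((hαt.sin.ofReal_comp.const_mul (α : ℂ)).fun_add
      (hαt.cos.ofReal_comp.const_mul (l * Complex.I)))).div_const _).congr_deriv ?_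
    have hl' : ((α ^ 2 - l ^ 2 : ℝ) : ℂ) ≠ 0 := by exact_mod_cast hl
    rw [div_eq_iff hl']
    push_cast
    linear_combination (l ^ 2 * Complex.cos (α * t) * Complex.exp (l * t * Complex.I)) *
      Complex.I_sq
  rw [cosTransform, intervalIntegral.integral_eq_sub_of_hasDerivAt (fun t _ => hderiv t)
    (Continuous.intervalIntegrable (by fun_prop) _ _)]
  have hneg : α * -R = -(Real.pi / 2) := by linarith
  rw [hαR, hneg, Real.sin_neg, Real.cos_neg, Real.sin_pi_div_two, Real.cos_pi_div_two, mul_neg]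
  push_cast
  rw [Complex.cos]
  ring_nf

theorem cosTransform_neg (α R l : ℝ) : cosTransform α R (-l) = cosTransform α R l := by
  have hreflect := intervalIntegral.integral_comp_neg (a := -R) (b := R)
    fun t => (Real.cos (α * t) : ℂ) * Complex.exp ((l * t : ℝ) * Complex.I)
  simpa only [cosTransform, mul_neg, neg_mul, neg_neg, Real.cos_neg] using hreflect

theorem norm_cosTransform_le {α R l : ℝ} (hα : 0 < α) (hαR : α * R = Real.pi / 2) (hl : α < |l|) :
    ‖cosTransform α R l‖ ≤ 2 * α / (l ^ 2 - α ^ 2) := by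
  have hpos : 0 < l ^ 2 - α ^ 2 := by
    rw [← sq_abs l]
    nlinarith
  rw [cosTransform_eq hαR (by linarith), Complex.norm_real, norm_div, norm_mul, ← norm_neg (_ - _),
    neg_sub, Real.norm_of_nonneg hpos.le, Real.norm_of_nonneg (by positivity : 0 ≤ 2 * α)]
  exact div_le_div_of_nonneg_right
    (mul_le_of_le_one_right (by positivity) (Real.abs_cos_le_one (l * R))) hpos.le

theorem cosTransform_zero {α R : ℝ} (hα : 0 < α) (hαR : α * R = Real.pi / 2) :
    cosTransform α R 0 = (2 / α : ℝ) := by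
  rw [cosTransform_eq hαR (by simpa using hα.ne')]
  congr 1
  simp only [zero_mul, Real.cos_zero]
  field_simp
  simp

theorem integral_cos_mul_norm_sq_expSum (ν : ι → ℝ) (F : Finset ι) (a : ι → ℂ) (α R : ℝ) :
    ((∫ t in -R..R, Real.cos (α * t) * ‖expSum ν F a t‖ ^ 2 : ℝ) : ℂ) =
      ∑ i ∈ F, ∑ j ∈ F, a i * conj (a j) * cosTransform α R (ν i - ν j) := by
  have hexpand : ∀ t : ℝ, ((Real.cos (α * t) * ‖expSum ν F a t‖ ^ 2 : ℝ) : ℂ) =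
      ∑ i ∈ F, ∑ j ∈ F, a i * conj (a j) *
        (Real.cos (α * t) * Complex.exp (((ν i - ν j) * t : ℝ) * Complex.I)) := fun t => by
    push_cast
    rw [← Complex.mul_conj', expSum, map_sum, Finset.sum_mul_sum, Finset.mul_sum]
    refine Finset.sum_congr rfl fun i _ => ?_
    rw [Finset.mul_sum]
    refine Finset.sum_congr rfl fun j _ => ?_
    rw [map_mul, ← Complex.exp_conj, map_mul, Complex.conj_ofReal, Complex.conj_I, sub_mul, sub_mul,
      Complex.exp_sub, mul_neg, Complex.exp_neg]
    push_cast
    ring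
  rw [← intervalIntegral.integral_ofReal, intervalIntegral.integral_congr fun t _ => hexpand t,
    intervalIntegral.integral_finsetSum fun i _ =>
      Continuous.intervalIntegrable (by fun_prop) _ _]
  refine Finset.sum_congr rfl fun i _ => ?_
  rw [intervalIntegral.integral_finsetSum fun j _ =>
    Continuous.intervalIntegrable (by fun_prop) _ _]
  exact Finset.sum_congr rfl fun j _ => intervalIntegral.integral_const_mul _ _

theorem norm_sum_sum_mul_conj_le {F : Finset ι} {G : ι → ι → ℂ} {D : ℝ}
    (hsymm : ∀ i ∈ F, ∀ j ∈ F, ‖G i j‖ = ‖G j i‖) (hrow : ∀ i ∈ F, ∑ j ∈ F, ‖G i j‖ ≤ D)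
    (a : ι → ℂ) :
    ‖∑ i ∈ F, ∑ j ∈ F, a i * conj (a j) * G i j‖ ≤ D * ∑ i ∈ F, ‖a i‖ ^ 2 := by
  have hamgm : ∀ i j, ‖a i * conj (a j) * G i j‖ ≤
      ‖G i j‖ * ‖a i‖ ^ 2 / 2 + ‖G i j‖ * ‖a j‖ ^ 2 / 2 := fun i j => by
    rw [norm_mul, norm_mul, RCLike.norm_conj]
    nlinarith [mul_nonneg (norm_nonneg (G i j)) (sq_nonneg (‖a i‖ - ‖a j‖))]
  have hswap : ∑ i ∈ F, ∑ j ∈ F, ‖G i j‖ * ‖a j‖ ^ 2 / 2 =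
      ∑ i ∈ F, ∑ j ∈ F, ‖G i j‖ * ‖a i‖ ^ 2 / 2 := by
    rw [Finset.sum_comm]
    exact Finset.sum_congr rfl fun i hi => Finset.sum_congr rfl fun j hj => by rw [hsymm j hj i hi]
  calc ‖∑ i ∈ F, ∑ j ∈ F, a i * conj (a j) * G i j‖
      ≤ ∑ i ∈ F, ∑ j ∈ F, (‖G i j‖ * ‖a i‖ ^ 2 / 2 + ‖G i j‖ * ‖a j‖ ^ 2 / 2) :=
        norm_sum_le_of_le F fun i _ => norm_sum_le_of_le F fun j _ => hamgm i j
    _ = ∑ i ∈ F, (∑ j ∈ F, ‖G i j‖) * ‖a i‖ ^ 2 := by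
        simp only [Finset.sum_add_distrib, hswap]
        simp only [← Finset.sum_add_distrib, add_halves, Finset.sum_mul]
    _ ≤ ∑ i ∈ F, D * ‖a i‖ ^ 2 := by
        gcongr with i hi
        exact hrow i hi
    _ = D * ∑ i ∈ F, ‖a i‖ ^ 2 := (Finset.mul_sum ..).symm

theorem sum_inv_four_mul_sq_sub_one_le {S : Finset ℕ} (hS : 0 ∉ S) :
    ∑ m ∈ S, (4 * (m : ℝ) ^ 2 - 1)⁻¹ ≤ 1 / 2 := by
  have htelescope : ∀ n : ℕ, ∑ m ∈ Finset.range n, (4 * ((m + 1 : ℕ) : ℝ) ^ 2 - 1)⁻¹ =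
      1 / 2 - 1 / (2 * (2 * (n : ℝ) + 1)) := fun n => by
    induction n with
    | zero => simp
    | succ n ih =>
      rw [Finset.sum_range_succ, ih]
      have hfactor : 4 * ((n + 1 : ℕ) : ℝ) ^ 2 - 1 = (2 * n + 1) * (2 * (n + 1 : ℕ) + 1) := by
        push_cast
        ring
      rw [hfactor]
      push_cast
      field_simp
      ring
  obtain ⟨n, hn⟩ := S.bddAbove
  have hsub : S ⊆ (Finset.range n).image Nat.succ := fun m hm =>
    Finset.mem_image.2 ⟨m - 1, by
      have := hn hm
      have : m ≠ 0 := fun h => hS (h ▸ hm)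
      simp only [Finset.mem_range]
      lia⟩
  calc ∑ m ∈ S, (4 * (m : ℝ) ^ 2 - 1)⁻¹
      ≤ ∑ m ∈ (Finset.range n).image Nat.succ, (4 * (m : ℝ) ^ 2 - 1)⁻¹ := by
        refine Finset.sum_le_sum_of_subset_of_nonneg hsub fun m hm _ => ?_
        obtain ⟨k, -, rfl⟩ := Finset.mem_image.1 hm
        push_cast [Nat.succ_eq_add_one]
        exact inv_nonneg.2 (by nlinarith [(Nat.cast_nonneg k : (0 : ℝ) ≤ k)])
    _ = 1 / 2 - 1 / (2 * (2 * (n : ℝ) + 1)) := by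
        rw [Finset.sum_image fun i _ j _ h => Nat.succ_injective h, htelescope]
    _ ≤ 1 / 2 := by
        have : 0 < 1 / (2 * (2 * (n : ℝ) + 1)) := by positivity
        linarith

theorem sum_inv_four_mul_sq_sub_one_le_of_one_le {F : Finset ι} {g : ι → ℝ}
    (hg : ∀ j ∈ F, 1 ≤ g j) (hsep : (F : Set ι).Pairwise fun j k => 1 ≤ |g j - g k|) :
    ∑ j ∈ F, (4 * g j ^ 2 - 1)⁻¹ ≤ 1 / 2 := by
  have hinj : Set.InjOn (fun j => ⌊g j⌋₊) F := fun j hj k hk hjk => by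
    by_contra hne
    have hj' := Nat.floor_le (zero_le_one.trans (hg j hj))
    have hk' := Nat.floor_le (zero_le_one.trans (hg k hk))
    have := Nat.lt_floor_add_one (g j)
    have := Nat.lt_floor_add_one (g k)
    have := hsep hj hk hne
    simp only at hjk
    rw [hjk] at *
    cases abs_cases (g j - g k) <;> linarith
  have hfloor : ∀ j ∈ F, (1 : ℝ) ≤ ⌊g j⌋₊ := fun j hj => by
    exact_mod_cast Nat.le_floor (by simpa using hg j hj)
  calc ∑ j ∈ F, (4 * g j ^ 2 - 1)⁻¹
      ≤ ∑ j ∈ F, (4 * (⌊g j⌋₊ : ℝ) ^ 2 - 1)⁻¹ := by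
        gcongr with j hj
        · nlinarith [hfloor j hj]
        · exact Nat.floor_le (zero_le_one.trans (hg j hj))
    _ = ∑ m ∈ F.image fun j => ⌊g j⌋₊, (4 * (m : ℝ) ^ 2 - 1)⁻¹ :=
        (Finset.sum_image (f := fun m : ℕ => (4 * (m : ℝ) ^ 2 - 1)⁻¹) hinj).symm
    _ ≤ 1 / 2 := sum_inv_four_mul_sq_sub_one_le fun h0 => by
        obtain ⟨j, hj, hj0⟩ := Finset.mem_image.1 h0
        have := hfloor j hj
        rw [hj0] at this
        norm_num at this

theorem sum_inv_four_mul_sq_sub_one_le_of_one_le_abs {F : Finset ι} {g : ι → ℝ}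
    (hg : ∀ j ∈ F, 1 ≤ |g j|) (hsep : (F : Set ι).Pairwise fun j k => 1 ≤ |g j - g k|) :
    ∑ j ∈ F, (4 * g j ^ 2 - 1)⁻¹ ≤ 1 := by
  have hpos : ∑ j ∈ F with 0 ≤ g j, (4 * g j ^ 2 - 1)⁻¹ ≤ 1 / 2 :=
    sum_inv_four_mul_sq_sub_one_le_of_one_le
      (fun j hj => by
        obtain ⟨hjF, hj0⟩ := Finset.mem_filter.1 hj
        simpa [abs_of_nonneg hj0] using hg j hjF)
      (hsep.mono (Finset.coe_subset.2 (Finset.filter_subset _ _)))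
  have hneg : ∑ j ∈ F with ¬ 0 ≤ g j, (4 * (-g j) ^ 2 - 1)⁻¹ ≤ 1 / 2 :=
    sum_inv_four_mul_sq_sub_one_le_of_one_le
      (fun j hj => by
        obtain ⟨hjF, hj0⟩ := Finset.mem_filter.1 hj
        simpa [abs_of_neg (not_le.1 hj0)] using hg j hjF)
      fun j hj k hk hjk => by
        simp only [neg_sub_neg, abs_sub_comm (g k)]
        exact hsep (Finset.mem_filter.1 hj).1 (Finset.mem_filter.1 hk).1 hjk
  simp only [neg_sq] at hneg
  linarith [Finset.sum_filter_add_sum_filter_not F (0 ≤ g ·) fun j => (4 * g j ^ 2 - 1)⁻¹]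

theorem sum_norm_cosTransform_le {F : Finset ι} {α R γ : ℝ} {g : ι → ℝ} (hα : 0 < α)
    (hαR : α * R = Real.pi / 2) (hαγ : 2 * α ≤ γ) (hg : ∀ j ∈ F, γ ≤ |g j|)
    (hsep : (F : Set ι).Pairwise fun j k => γ ≤ |g j - g k|) :
    ∑ j ∈ F, ‖cosTransform α R (g j)‖ ≤ 8 * α / γ ^ 2 := by
  have hγ : 0 < γ := by linarith
  have hterm : ∀ j ∈ F, ‖cosTransform α R (g j)‖ ≤
      8 * α / γ ^ 2 * (4 * (g j / γ) ^ 2 - 1)⁻¹ := fun j hj => by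
    have hgj := hg j hj
    have hsq : γ ^ 2 ≤ g j ^ 2 := by
      rw [← sq_abs (g j)]
      gcongr
    have hpos : 0 < 4 * g j ^ 2 - γ ^ 2 := by nlinarith
    calc ‖cosTransform α R (g j)‖ ≤ 2 * α / (g j ^ 2 - α ^ 2) :=
          norm_cosTransform_le hα hαR (by linarith)
      _ ≤ 2 * α / (g j ^ 2 - γ ^ 2 / 4) := by
          gcongr
          · linarith
          · nlinarith
      _ = 8 * α / γ ^ 2 * (4 * (g j / γ) ^ 2 - 1)⁻¹ := by
          have : g j ^ 2 - γ ^ 2 / 4 ≠ 0 := by linarith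
          have : 4 * (g j / γ) ^ 2 - 1 ≠ 0 := by
            rw [div_pow, ← mul_div_assoc, div_sub_one (by positivity)]
            positivity
          field_simp
          ring
  calc ∑ j ∈ F, ‖cosTransform α R (g j)‖
      ≤ ∑ j ∈ F, 8 * α / γ ^ 2 * (4 * (g j / γ) ^ 2 - 1)⁻¹ := Finset.sum_le_sum hterm
    _ ≤ 8 * α / γ ^ 2 * 1 := by
        rw [← Finset.mul_sum]
        gcongr
        refine sum_inv_four_mul_sq_sub_one_le_of_one_le_abs (fun j hj => ?_) fun j hj k hk hjk => ?_
        · rw [abs_div, abs_of_pos hγ, one_le_div hγ]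
          exact hg j hj
        · simp only [← sub_div, abs_div, abs_of_pos hγ, one_le_div hγ]
          exact hsep hj hk hjk
    _ = 8 * α / γ ^ 2 := mul_one _

theorem abs_integral_cos_mul_norm_sq_expSum_sub_le {ν : ι → ℝ} {F : Finset ι} {α R γ : ℝ}
    (hα : 0 < α) (hαR : α * R = Real.pi / 2) (hαγ : 2 * α ≤ γ)
    (hsep : (F : Set ι).Pairwise fun i j => γ ≤ |ν i - ν j|) (a : ι → ℂ) :
    |(∫ t in -R..R, Real.cos (α * t) * ‖expSum ν F a t‖ ^ 2) - 2 / α * ∑ i ∈ F, ‖a i‖ ^ 2| ≤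
      8 * α / γ ^ 2 * ∑ i ∈ F, ‖a i‖ ^ 2 := by
  classical
  let G : ι → ι → ℂ := fun i j => if j = i then 0 else cosTransform α R (ν i - ν j)
  have hsymm : ∀ i ∈ F, ∀ j ∈ F, ‖G i j‖ = ‖G j i‖ := fun i _ j _ => by
    simp only [G, eq_comm (a := j), ← cosTransform_neg α R (ν i - ν j), neg_sub]
  have hrow : ∀ i ∈ F, ∑ j ∈ F, ‖G i j‖ ≤ 8 * α / γ ^ 2 := fun i hi => by
    calc ∑ j ∈ F, ‖G i j‖ = ∑ j ∈ F with j ≠ i, ‖cosTransform α R (ν i - ν j)‖ := by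
          rw [Finset.sum_filter]
          refine Finset.sum_congr rfl fun j _ => ?_
          by_cases hji : j = i <;> simp [G, hji]
      _ ≤ 8 * α / γ ^ 2 := by
          refine sum_norm_cosTransform_le hα hαR hαγ (fun j hj => ?_) fun j hj k hk hjk => ?_
          · obtain ⟨hjF, hji⟩ := Finset.mem_filter.1 hj
            exact hsep hi hjF hji.symm
          · simp only [sub_sub_sub_cancel_left, abs_sub_comm (ν k)]
            exact hsep (Finset.mem_filter.1 hj).1 (Finset.mem_filter.1 hk).1 hjk
  have hsplit : ∀ i ∈ F, ∑ j ∈ F, a i * conj (a j) * cosTransform α R (ν i - ν j) =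
      (2 / α * ‖a i‖ ^ 2 : ℝ) + ∑ j ∈ F, a i * conj (a j) * G i j := fun i hi => by
    rw [← Finset.add_sum_erase F _ hi, ← Finset.add_sum_erase F _ hi, sub_self,
      cosTransform_zero hα hαR, Complex.mul_conj']
    simp only [G, if_true, mul_zero, zero_add]
    push_cast
    rw [mul_comm]
    congr 1
    exact Finset.sum_congr rfl fun j hj => by rw [if_neg (Finset.ne_of_mem_erase hj)]
  have hoff : (((∫ t in -R..R, Real.cos (α * t) * ‖expSum ν F a t‖ ^ 2) -
      2 / α * ∑ i ∈ F, ‖a i‖ ^ 2 : ℝ) : ℂ) = ∑ i ∈ F, ∑ j ∈ F, a i * conj (a j) * G i j := by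
    rw [Complex.ofReal_sub, integral_cos_mul_norm_sq_expSum, Finset.sum_congr rfl hsplit,
      Finset.sum_add_distrib, ← Complex.ofReal_sum, ← Finset.mul_sum, add_sub_cancel_left]
  rw [← Real.norm_eq_abs, ← Complex.norm_real, hoff]
  exact norm_sum_sum_mul_conj_le hsymm hrow a

theorem intervalIntegrable_norm_sq_expSum (ν : ι → ℝ) (F : Finset ι) (a : ι → ℂ) (p q : ℝ) :
    IntervalIntegrable (fun t => ‖expSum ν F a t‖ ^ 2) volume p q :=
  ((continuous_expSum ν F a).norm.pow 2).intervalIntegrable p q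

theorem integral_norm_sq_expSum_mono {p q p' q' : ℝ} (hp : p' ≤ p) (hpq : p ≤ q) (hq : q ≤ q')
    (ν : ι → ℝ) (F : Finset ι) (a : ι → ℂ) :
    ∫ t in p..q, ‖expSum ν F a t‖ ^ 2 ≤ ∫ t in p'..q', ‖expSum ν F a t‖ ^ 2 :=
  intervalIntegral.integral_mono_interval hp hpq hq (Eventually.of_forall fun _ => sq_nonneg _)
    (intervalIntegrable_norm_sq_expSum ν F a p' q')

theorem integral_norm_sq_expSum_nonneg {p q : ℝ} (hpq : p ≤ q) (ν : ι → ℝ) (F : Finset ι)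
    (a : ι → ℂ) : 0 ≤ ∫ t in p..q, ‖expSum ν F a t‖ ^ 2 :=
  intervalIntegral.integral_nonneg hpq fun _ _ => sq_nonneg _

theorem exists_mul_sum_le_integral_expSum {ν : ι → ℝ} {s : Set ι} {γ R : ℝ} (hγ : 0 < γ)
    (hsep : s.Pairwise fun i j => γ ≤ |ν i - ν j|) (hR : Real.pi / γ < R) :
    ∃ c > 0, ∀ (F : Finset ι) (a : ι → ℂ), (F : Set ι) ⊆ s →
      c * ∑ i ∈ F, ‖a i‖ ^ 2 ≤ ∫ t in -R..R, ‖expSum ν F a t‖ ^ 2 := by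
  have hR0 : 0 < R := (by positivity : 0 < Real.pi / γ).trans hR
  set α := Real.pi / (2 * R) with hα
  have hα0 : 0 < α := by positivity
  have hαγ : 2 * α < γ := by
    rw [div_lt_iff₀ hγ] at hR
    rw [hα, ← mul_div_assoc, div_lt_iff₀ (by positivity)]
    linarith
  refine ⟨2 / α - 8 * α / γ ^ 2, ?_, fun F a hF => ?_⟩
  · rw [gt_iff_lt, sub_pos, div_lt_div_iff₀ (by positivity) hα0]
    nlinarith
  have hwindow := abs_integral_cos_mul_norm_sq_expSum_sub_le hα0
    (by rw [hα]; field_simp : α * R = Real.pi / 2) hαγ.le (hsep.mono hF) a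
  calc (2 / α - 8 * α / γ ^ 2) * ∑ i ∈ F, ‖a i‖ ^ 2
      ≤ ∫ t in -R..R, Real.cos (α * t) * ‖expSum ν F a t‖ ^ 2 := by
        linarith [(abs_le.1 hwindow).1]
    _ ≤ ∫ t in -R..R, ‖expSum ν F a t‖ ^ 2 := by
        have hcont := continuous_expSum ν F a
        refine intervalIntegral.integral_mono_on (by linarith)
          (Continuous.intervalIntegrable (by fun_prop) _ _)
          (intervalIntegrable_norm_sq_expSum ν F a _ _) fun t _ => ?_
        exact mul_le_of_le_one_left (sq_nonneg _) (Real.cos_le_one _)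

theorem half_le_cos_mul {α R t : ℝ} (hα : 0 ≤ α) (hαR : α * R ≤ Real.pi / 3)
    (ht : t ∈ Icc (-R) R) : 1 / 2 ≤ Real.cos (α * t) := by
  have habs : |α * t| ≤ α * R := by
    rw [abs_mul, abs_of_nonneg hα]
    exact mul_le_mul_of_nonneg_left (abs_le.2 ht) hα
  rw [← Real.cos_pi_div_three, ← Real.cos_abs (α * t)]
  exact Real.cos_le_cos_of_nonneg_of_le_pi (abs_nonneg _) (by linarith [Real.pi_pos])
    (habs.trans hαR)

theorem exists_integral_expSum_le_mul_sum {ν : ι → ℝ} {s : Set ι} {γ R : ℝ} (hγ : 0 < γ)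
    (hsep : s.Pairwise fun i j => γ ≤ |ν i - ν j|) (hR : 0 ≤ R) :
    ∃ C ≥ 0, ∀ (F : Finset ι) (a : ι → ℂ), (F : Set ι) ⊆ s →
      ∫ t in -R..R, ‖expSum ν F a t‖ ^ 2 ≤ C * ∑ i ∈ F, ‖a i‖ ^ 2 := by
  -- On the wider window `[-R', R']` the weight `cos (αt)` is at least `1 / 2` throughout `[-R, R]`.
  set R' := max (3 / 2 * R) (Real.pi / γ)
  have hRR' : 3 / 2 * R ≤ R' := le_max_left ..
  have hγR' : Real.pi / γ ≤ R' := le_max_right ..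
  have hR'0 : 0 < R' := (by positivity : 0 < Real.pi / γ).trans_le hγR'
  set α := Real.pi / (2 * R') with hα
  have hα0 : 0 < α := by positivity
  have hαR' : α * R' = Real.pi / 2 := by rw [hα]; field_simp
  have hαγ : 2 * α ≤ γ := by
    rw [div_le_iff₀ hγ] at hγR'
    rw [hα, ← mul_div_assoc, div_le_iff₀ (by positivity)]
    linarith
  refine ⟨2 * (2 / α + 8 * α / γ ^ 2), by positivity, fun F a hF => ?_⟩
  have hcont := continuous_expSum ν F a
  have hint : ∀ p q, IntervalIntegrable (fun t => Real.cos (α * t) * ‖expSum ν F a t‖ ^ 2)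
      volume p q := fun p q => Continuous.intervalIntegrable (by fun_prop) p q
  have hαR : α * R ≤ Real.pi / 3 := by nlinarith
  have hwindow := abs_integral_cos_mul_norm_sq_expSum_sub_le hα0 hαR' hαγ (hsep.mono hF) a
  calc ∫ t in -R..R, ‖expSum ν F a t‖ ^ 2
      ≤ ∫ t in -R..R, 2 * (Real.cos (α * t) * ‖expSum ν F a t‖ ^ 2) := by
        refine intervalIntegral.integral_mono_on (by linarith)
          (intervalIntegrable_norm_sq_expSum ν F a _ _) ((hint _ _).const_mul 2) fun t ht => ?_
        nlinarith [mul_le_mul_of_nonneg_right (half_le_cos_mul hα0.le hαR ht)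
          (sq_nonneg ‖expSum ν F a t‖)]
    _ = 2 * ∫ t in -R..R, Real.cos (α * t) * ‖expSum ν F a t‖ ^ 2 :=
        intervalIntegral.integral_const_mul _ _
    _ ≤ 2 * ∫ t in -R'..R', Real.cos (α * t) * ‖expSum ν F a t‖ ^ 2 := by
        gcongr
        refine intervalIntegral.integral_mono_interval (by linarith) (by linarith) (by linarith)
          ((ae_restrict_mem measurableSet_Ioc).mono fun t ht => ?_) (hint _ _)
        refine mul_nonneg (Real.cos_nonneg_of_neg_pi_div_two_le_of_le ?_ ?_) (sq_nonneg _) <;>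
          nlinarith [ht.1, ht.2]
    _ ≤ 2 * (2 / α + 8 * α / γ ^ 2) * ∑ i ∈ F, ‖a i‖ ^ 2 := by
        linarith [(abs_le.1 hwindow).2]

theorem integral_exp_mul_mul_I (x δ : ℝ) :
    ∫ s in -δ..δ, Complex.exp ((x * s : ℝ) * Complex.I) = 2 * δ * Real.sinc (x * δ) := by
  rcases eq_or_ne x 0 with rfl | hx
  · simp only [zero_mul, Complex.ofReal_zero, Complex.exp_zero, intervalIntegral.integral_const,
      Real.sinc_zero, Complex.ofReal_one, mul_one, Complex.real_smul]
    push_cast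
    ring
  · rw [intervalIntegral.integral_comp_mul_left (fun s : ℝ => Complex.exp (s * Complex.I)) hx,
      mul_neg, integral_exp_mul_I_eq_sinc, Complex.real_smul]
    push_cast
    have : (x : ℂ) ≠ 0 := by exact_mod_cast hx
    field_simp

theorem sinc_lt_one {x : ℝ} (hx : 0 < x) : Real.sinc x < 1 := by
  rw [Real.sinc_of_ne_zero hx.ne', div_lt_one hx]
  exact Real.sin_lt hx

theorem exists_pos_le_one_sub_sinc {x₀ : ℝ} (hx₀ : 0 < x₀) :
    ∃ c > 0, ∀ x, x₀ ≤ |x| → c ≤ 1 - Real.sinc x := by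
  obtain ⟨y, hy, hmin⟩ := (isCompact_Icc (a := x₀) (b := max x₀ 2)).exists_isMinOn
    (nonempty_Icc.2 (le_max_left ..)) (continuous_const.sub Real.continuous_sinc).continuousOn
    (f := fun x => 1 - Real.sinc x)
  have hy1 : 0 < 1 - Real.sinc y := sub_pos.2 (sinc_lt_one (hx₀.trans_le hy.1))
  refine ⟨min (1 - Real.sinc y) (1 / 2), lt_min hy1 one_half_pos, fun x hx => ?_⟩
  rcases le_total |x| (max x₀ 2) with hle | hle
  · have hsinc : Real.sinc |x| = Real.sinc x := by
      rcases abs_choice x with h | h <;> rw [h]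
      exact Real.sinc_neg x
    exact (min_le_left ..).trans (hsinc ▸ hmin ⟨hx, hle⟩)
  · have hx2 : 2 ≤ |x| := (le_max_right ..).trans hle
    have hinv : |x|⁻¹ ≤ 2⁻¹ := inv_anti₀ two_pos hx2
    have := Real.sinc_le_inv_abs (abs_pos.1 (hx₀.trans_le hx))
    exact (min_le_right ..).trans (by linarith)

theorem norm_intervalAverage_sq_le {E : Type*} [NormedAddCommGroup E] [NormedSpace ℝ E]
    [CompleteSpace E] {f : ℝ → E} (hf : Continuous f) {p q : ℝ} (hpq : p < q) :
    ‖⨍ s in p..q, f s‖ ^ 2 ≤ ⨍ s in p..q, ‖f s‖ ^ 2 := by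
  have hconvex : ConvexOn ℝ univ fun z : E => ‖z‖ ^ 2 :=
    (convexOn_norm convex_univ).pow (fun z _ => norm_nonneg z) 2
  rw [uIoc_of_le hpq.le]
  refine hconvex.map_set_average_le (by fun_prop) isClosed_univ (by simp [hpq])
    measure_Ioc_lt_top.ne (ae_of_all _ fun _ => mem_univ _) ?_ ?_
  · exact hf.integrableOn_Ioc
  · exact (hf.norm.pow 2).integrableOn_Ioc

theorem expSum_sub_intervalAverage (ν : ι → ℝ) (F : Finset ι) (a : ι → ℂ) (μ t : ℝ) {δ : ℝ}
    (hδ : 0 < δ) :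
    expSum ν F a t -
        ⨍ s in -δ..δ, Complex.exp ((-(μ * s) : ℝ) * Complex.I) * expSum ν F a (t + s) =
      expSum ν F (fun i => a i * (1 - Real.sinc ((ν i - μ) * δ) : ℝ)) t := by
  have hexpand : ∀ s, Complex.exp ((-(μ * s) : ℝ) * Complex.I) * expSum ν F a (t + s) =
      ∑ i ∈ F, a i * Complex.exp ((ν i * t : ℝ) * Complex.I) *
        Complex.exp (((ν i - μ) * s : ℝ) * Complex.I) := fun s => by
    rw [expSum, Finset.mul_sum]
    refine Finset.sum_congr rfl fun i _ => ?_
    rw [mul_left_comm, mul_assoc, ← Complex.exp_add, ← Complex.exp_add]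
    push_cast
    ring_nf
  have hδ' : (δ : ℂ) ≠ 0 := by exact_mod_cast hδ.ne'
  rw [interval_average_eq, intervalIntegral.integral_congr fun s _ => hexpand s,
    intervalIntegral.integral_finsetSum fun i _ => Continuous.intervalIntegrable (by fun_prop) _ _,
    expSum, expSum, Finset.smul_sum, ← Finset.sum_sub_distrib]
  refine Finset.sum_congr rfl fun i _ => ?_
  rw [intervalIntegral.integral_const_mul, integral_exp_mul_mul_I, Complex.real_smul]
  push_cast
  field_simp
  ring

theorem norm_sq_expSum_sinc_le (ν : ι → ℝ) (F : Finset ι) (a : ι → ℂ) (μ : ℝ) {δ : ℝ} (hδ : 0 < δ)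
    (t : ℝ) :
    ‖expSum ν F (fun i => a i * (1 - Real.sinc ((ν i - μ) * δ) : ℝ)) t‖ ^ 2 ≤
      2 * ‖expSum ν F a t‖ ^ 2 + (∫ s in t - δ..t + δ, ‖expSum ν F a s‖ ^ 2) / δ := by
  have hcont := continuous_expSum ν F a
  set A := ⨍ s in -δ..δ, Complex.exp ((-(μ * s) : ℝ) * Complex.I) * expSum ν F a (t + s) with hA
  have hjensen : 2 * ‖A‖ ^ 2 ≤ (∫ s in t - δ..t + δ, ‖expSum ν F a s‖ ^ 2) / δ := by
    calc 2 * ‖A‖ ^ 2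
        ≤ 2 * ⨍ s in -δ..δ,
            ‖Complex.exp ((-(μ * s) : ℝ) * Complex.I) * expSum ν F a (t + s)‖ ^ 2 := by
          gcongr
          exact norm_intervalAverage_sq_le (by fun_prop) (by linarith)
      _ = (∫ s in t - δ..t + δ, ‖expSum ν F a s‖ ^ 2) / δ := by
          simp only [norm_mul, Complex.norm_exp_ofReal_mul_I, one_mul]
          rw [interval_average_eq, intervalIntegral.integral_comp_add_left
            fun s => ‖expSum ν F a s‖ ^ 2, smul_eq_mul, ← sub_eq_add_neg]
          field_simp
          ring
  rw [← expSum_sub_intervalAverage ν F a μ t hδ, ← hA]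
  have htriangle := norm_sub_le (expSum ν F a t) A
  nlinarith [sq_nonneg (‖expSum ν F a t‖ - ‖A‖), norm_nonneg (expSum ν F a t - A)]

theorem integral_norm_sq_expSum_sinc_le (ν : ι → ℝ) (F : Finset ι) (a : ι → ℂ) (μ : ℝ) {δ R : ℝ}
    (hδ : 0 < δ) (hδR : δ ≤ R) :
    ∫ t in -(R - δ)..(R - δ),
        ‖expSum ν F (fun i => a i * (1 - Real.sinc ((ν i - μ) * δ) : ℝ)) t‖ ^ 2 ≤
      2 * R / δ * ∫ t in -R..R, ‖expSum ν F a t‖ ^ 2 := by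
  set J := ∫ t in -R..R, ‖expSum ν F a t‖ ^ 2
  have hpointwise : ∀ t ∈ Icc (-(R - δ)) (R - δ),
      ‖expSum ν F (fun i => a i * (1 - Real.sinc ((ν i - μ) * δ) : ℝ)) t‖ ^ 2 ≤
        2 * ‖expSum ν F a t‖ ^ 2 + J / δ := fun t ht => by
    refine (norm_sq_expSum_sinc_le ν F a μ hδ t).trans ?_
    gcongr
    exact integral_norm_sq_expSum_mono (by linarith [ht.1]) (by linarith) (by linarith [ht.2]) ν F a
  have hint := intervalIntegrable_norm_sq_expSum ν F a (-(R - δ)) (R - δ)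
  calc ∫ t in -(R - δ)..(R - δ),
        ‖expSum ν F (fun i => a i * (1 - Real.sinc ((ν i - μ) * δ) : ℝ)) t‖ ^ 2
      ≤ ∫ t in -(R - δ)..(R - δ), (2 * ‖expSum ν F a t‖ ^ 2 + J / δ) :=
        intervalIntegral.integral_mono_on (by linarith) (intervalIntegrable_norm_sq_expSum ..)
          ((hint.const_mul 2).add intervalIntegrable_const) hpointwise
    _ = 2 * (∫ t in -(R - δ)..(R - δ), ‖expSum ν F a t‖ ^ 2) + 2 * (R - δ) * (J / δ) := by
        rw [intervalIntegral.integral_add (hint.const_mul 2) intervalIntegrable_const,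
          intervalIntegral.integral_const_mul, intervalIntegral.integral_const, smul_eq_mul]
        ring
    _ ≤ 2 * J + 2 * (R - δ) * (J / δ) := by
        gcongr
        exact integral_norm_sq_expSum_mono (by linarith) (by linarith) (by linarith) ν F a
    _ = 2 * R / δ * J := by
        field_simp
        ring

theorem exists_mul_sum_erase_le_integral_expSum [DecidableEq ι] {ν : ι → ℝ} {i₀ : ι} {γ d R : ℝ}
    (hγ : 0 < γ) (hd : 0 < d) (hsep : ({i₀}ᶜ : Set ι).Pairwise fun i j => γ ≤ |ν i - ν j|)
    (hi₀ : ∀ i ≠ i₀, d ≤ |ν i - ν i₀|) (hR : Real.pi / γ < R) :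
    ∃ c > 0, ∀ (F : Finset ι) (a : ι → ℂ),
      c * ∑ i ∈ F.erase i₀, ‖a i‖ ^ 2 ≤ ∫ t in -R..R, ‖expSum ν F a t‖ ^ 2 := by
  set δ := (R - Real.pi / γ) / 2 with hδ
  have hπγ : 0 < Real.pi / γ := by positivity
  have hδ0 : 0 < δ := by linarith
  have hR0 : 0 < R := hπγ.trans hR
  obtain ⟨c, hc, hingham⟩ := exists_mul_sum_le_integral_expSum hγ hsep
    (by linarith : Real.pi / γ < R - δ)
  obtain ⟨κ, hκ, hsinc⟩ := exists_pos_le_one_sub_sinc (mul_pos hd hδ0)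
  refine ⟨δ / (2 * R) * (c * κ ^ 2), by positivity, fun F a => ?_⟩
  set a' : ι → ℂ := fun i => a i * (1 - Real.sinc ((ν i - ν i₀) * δ) : ℝ) with ha'
  have ha'i₀ : a' i₀ = 0 := by simp [ha']
  have herase : expSum ν (F.erase i₀) a' = expSum ν F a' :=
    funext fun t => Finset.sum_erase F (by rw [ha'i₀, zero_mul])
  have ha'_le : ∀ i ∈ F.erase i₀, κ ^ 2 * ‖a i‖ ^ 2 ≤ ‖a' i‖ ^ 2 := fun i hi => by
    have hκi : κ ≤ 1 - Real.sinc ((ν i - ν i₀) * δ) := hsinc _ (by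
      rw [abs_mul, abs_of_pos hδ0]
      exact mul_le_mul_of_nonneg_right (hi₀ i (Finset.ne_of_mem_erase hi)) hδ0.le)
    rw [ha', norm_mul, Complex.norm_real, Real.norm_of_nonneg (hκ.le.trans hκi), mul_pow,
      mul_comm]
    gcongr
  calc δ / (2 * R) * (c * κ ^ 2) * ∑ i ∈ F.erase i₀, ‖a i‖ ^ 2
      = δ / (2 * R) * (c * ∑ i ∈ F.erase i₀, κ ^ 2 * ‖a i‖ ^ 2) := by
        rw [← Finset.mul_sum]
        ring
    _ ≤ δ / (2 * R) * (c * ∑ i ∈ F.erase i₀, ‖a' i‖ ^ 2) := by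
        gcongr with i hi
        exact ha'_le i hi
    _ ≤ δ / (2 * R) * ∫ t in -(R - δ)..(R - δ), ‖expSum ν F a' t‖ ^ 2 := by
        gcongr
        simpa only [herase] using hingham (F.erase i₀) a' fun i hi => by
          simpa using Finset.ne_of_mem_erase (Finset.mem_coe.1 hi)
    _ ≤ δ / (2 * R) * (2 * R / δ * ∫ t in -R..R, ‖expSum ν F a t‖ ^ 2) := by
        gcongr
        exact integral_norm_sq_expSum_sinc_le ν F a (ν i₀) hδ0 (by linarith)
    _ = ∫ t in -R..R, ‖expSum ν F a t‖ ^ 2 := by field_simp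

theorem mul_norm_sq_le_integral_expSum_add_erase [DecidableEq ι] {ν : ι → ℝ} {F : Finset ι} {i₀ : ι}
    (hi₀ : i₀ ∈ F) (a : ι → ℂ) {R : ℝ} (hR : 0 ≤ R) :
    R * ‖a i₀‖ ^ 2 ≤ (∫ t in -R..R, ‖expSum ν F a t‖ ^ 2) +
      ∫ t in -R..R, ‖expSum ν (F.erase i₀) a t‖ ^ 2 := by
  have hpointwise : ∀ t, ‖a i₀‖ ^ 2 / 2 ≤
      ‖expSum ν F a t‖ ^ 2 + ‖expSum ν (F.erase i₀) a t‖ ^ 2 := fun t => by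
    have hterm : ‖a i₀‖ = ‖expSum ν F a t - expSum ν (F.erase i₀) a t‖ := by
      rw [expSum, expSum, ← Finset.add_sum_erase F _ hi₀, add_sub_cancel_right, norm_mul,
        Complex.norm_exp_ofReal_mul_I, mul_one]
    have htriangle := hterm.trans_le (norm_sub_le _ _)
    nlinarith [sq_nonneg (‖expSum ν F a t‖ - ‖expSum ν (F.erase i₀) a t‖), norm_nonneg (a i₀)]
  have hF := intervalIntegrable_norm_sq_expSum ν F a (-R) R
  have herase := intervalIntegrable_norm_sq_expSum ν (F.erase i₀) a (-R) R
  rw [← intervalIntegral.integral_add hF herase]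
  calc R * ‖a i₀‖ ^ 2 = ∫ _ in -R..R, ‖a i₀‖ ^ 2 / 2 := by
        rw [intervalIntegral.integral_const, smul_eq_mul]
        ring
    _ ≤ ∫ t in -R..R, (‖expSum ν F a t‖ ^ 2 + ‖expSum ν (F.erase i₀) a t‖ ^ 2) :=
        intervalIntegral.integral_mono_on (by linarith) intervalIntegrable_const (hF.add herase)
          fun t _ => hpointwise t

theorem exists_mul_sum_le_integral_expSum_of_compl_singleton {ν : ι → ℝ} {i₀ : ι} {γ d R : ℝ}
    (hγ : 0 < γ) (hd : 0 < d) (hsep : ({i₀}ᶜ : Set ι).Pairwise fun i j => γ ≤ |ν i - ν j|)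
    (hi₀ : ∀ i ≠ i₀, d ≤ |ν i - ν i₀|) (hR : Real.pi / γ < R) :
    ∃ c > 0, ∀ (F : Finset ι) (a : ι → ℂ),
      c * ∑ i ∈ F, ‖a i‖ ^ 2 ≤ ∫ t in -R..R, ‖expSum ν F a t‖ ^ 2 := by
  classical
  have hR0 : 0 < R := (by positivity : 0 < Real.pi / γ).trans hR
  obtain ⟨c, hc, htail⟩ := exists_mul_sum_erase_le_integral_expSum hγ hd hsep hi₀ hR
  obtain ⟨C, hC, hupper⟩ := exists_integral_expSum_le_mul_sum hγ hsep hR0.le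
  refine ⟨(c⁻¹ + R⁻¹ * (1 + C * c⁻¹))⁻¹, by positivity, fun F a => ?_⟩
  rw [inv_mul_le_iff₀ (by positivity)]
  set J := ∫ t in -R..R, ‖expSum ν F a t‖ ^ 2
  have htail' : ∑ i ∈ F.erase i₀, ‖a i‖ ^ 2 ≤ c⁻¹ * J := (le_inv_mul_iff₀ hc).2 (htail F a)
  by_cases hF : i₀ ∈ F
  · have hhead : ‖a i₀‖ ^ 2 ≤ R⁻¹ * ((1 + C * c⁻¹) * J) := by
      rw [le_inv_mul_iff₀ hR0]
      calc R * ‖a i₀‖ ^ 2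
          ≤ J + ∫ t in -R..R, ‖expSum ν (F.erase i₀) a t‖ ^ 2 :=
            mul_norm_sq_le_integral_expSum_add_erase hF a hR0.le
        _ ≤ J + C * (c⁻¹ * J) := by
            gcongr
            refine (hupper _ a fun i hi => ?_).trans (by gcongr)
            simpa using Finset.ne_of_mem_erase (Finset.mem_coe.1 hi)
        _ = (1 + C * c⁻¹) * J := by ring
    rw [← Finset.add_sum_erase F _ hF]
    linarith
  · have hJ : 0 ≤ J := integral_norm_sq_expSum_nonneg (by linarith) ν F a
    rw [Finset.erase_eq_of_notMem hF] at htail'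
    have : 0 ≤ R⁻¹ * (1 + C * c⁻¹) * J := by positivity
    linarith

theorem exists_mul_sum_le_integral_expSum_zero {ν : ι → ℝ} {i₀ : ι} {γ d T : ℝ}
    (hγ : 0 < γ) (hd : 0 < d) (hsep : ({i₀}ᶜ : Set ι).Pairwise fun i j => γ ≤ |ν i - ν j|)
    (hi₀ : ∀ i ≠ i₀, d ≤ |ν i - ν i₀|) (hT : 2 * Real.pi / γ < T) :
    ∃ c > 0, ∀ (F : Finset ι) (a : ι → ℂ),
      c * ∑ i ∈ F, ‖a i‖ ^ 2 ≤ ∫ t in (0 : ℝ)..T, ‖expSum ν F a t‖ ^ 2 := by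
  have hR : Real.pi / γ < T / 2 := by
    rw [mul_div_assoc] at hT
    linarith
  obtain ⟨c, hc, hlower⟩ :=
    exists_mul_sum_le_integral_expSum_of_compl_singleton hγ hd hsep hi₀ hR
  refine ⟨c, hc, fun F a => ?_⟩
  have hshift : ∀ t, ‖expSum ν F a (t + T / 2)‖ =
      ‖expSum ν F (fun i => a i * Complex.exp ((ν i * (T / 2) : ℝ) * Complex.I)) t‖ := fun t => by
    refine congrArg norm (Finset.sum_congr rfl fun i _ => ?_)
    rw [mul_assoc, ← Complex.exp_add]
    push_cast
    ring_nf
  calc c * ∑ i ∈ F, ‖a i‖ ^ 2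
      = c * ∑ i ∈ F, ‖a i * Complex.exp ((ν i * (T / 2) : ℝ) * Complex.I)‖ ^ 2 := by
        simp only [norm_mul, Complex.norm_exp_ofReal_mul_I, mul_one]
    _ ≤ ∫ t in -(T / 2)..(T / 2), ‖expSum ν F a (t + T / 2)‖ ^ 2 := by
        simp only [hshift]
        exact hlower F _
    _ = ∫ t in (0 : ℝ)..T, ‖expSum ν F a t‖ ^ 2 := by
        rw [intervalIntegral.integral_comp_add_right fun t => ‖expSum ν F a t‖ ^ 2,
          neg_add_cancel, add_halves]

end ExpSum

/-! ### Moment problems -/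

section HilbertSpace

variable {ι 𝕜 E : Type*} [RCLike 𝕜] [NormedAddCommGroup E] [InnerProductSpace 𝕜 E]

theorem sum_norm_inner_sq_le {e : ι → E} {F : Finset ι} {C : ℝ} (hC : 0 ≤ C)
    (hupper : ∀ a : ι → 𝕜, ‖∑ i ∈ F, a i • e i‖ ^ 2 ≤ C * ∑ i ∈ F, ‖a i‖ ^ 2) (u : E) :
    ∑ i ∈ F, ‖inner 𝕜 (e i) u‖ ^ 2 ≤ C * ‖u‖ ^ 2 := by
  set S := ∑ i ∈ F, ‖inner 𝕜 (e i) u‖ ^ 2 with hS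
  set w := ∑ i ∈ F, inner 𝕜 (e i) u • e i
  have hS0 : 0 ≤ S := Finset.sum_nonneg fun i _ => sq_nonneg _
  have hdual : inner 𝕜 w u = (S : 𝕜) := by
    simp only [w, hS, sum_inner, inner_smul_left, RCLike.conj_mul]
    push_cast
    rfl
  have hsq : S ^ 2 ≤ C * S * ‖u‖ ^ 2 := by
    calc S ^ 2 = ‖inner 𝕜 w u‖ ^ 2 := by rw [hdual, RCLike.norm_ofReal, sq_abs]
      _ ≤ (‖w‖ * ‖u‖) ^ 2 := by
        gcongr
        exact norm_inner_le_norm w u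
      _ = ‖w‖ ^ 2 * ‖u‖ ^ 2 := mul_pow ..
      _ ≤ C * S * ‖u‖ ^ 2 := by
        gcongr
        exact hupper _
  rcases hS0.eq_or_lt with h0 | hpos
  · rw [← h0]
    positivity
  · nlinarith

theorem exists_strongDual_apply_eq {G : Type*} [NormedAddCommGroup G] [NormedSpace 𝕜 G]
    {e : ι → G} {y : ι → 𝕜} {M : ℝ}
    (hM : ∀ (F : Finset ι) (a : ι → 𝕜), ‖∑ i ∈ F, a i * y i‖ ≤ M * ‖∑ i ∈ F, a i • e i‖) :
    ∃ g : StrongDual 𝕜 G, ∀ i, g (e i) = y i := by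
  set L := Finsupp.linearCombination 𝕜 e with hL
  set Y := Finsupp.linearCombination 𝕜 y with hY
  have hYL : ∀ a, ‖Y a‖ ≤ M * ‖L a‖ := fun a => by
    simpa only [hL, hY, Finsupp.linearCombination_apply, Finsupp.sum, smul_eq_mul] using
      hM a.support a
  have hker : LinearMap.ker L ≤ LinearMap.ker Y := fun a ha => by
    rw [LinearMap.mem_ker] at ha ⊢
    simpa [ha] using hYL a
  let φ : LinearMap.range L →ₗ[𝕜] 𝕜 :=
    (LinearMap.ker L).liftQ Y hker ∘ₗ L.quotKerEquivRange.symm.toLinearMap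
  have hφ : ∀ a, φ ⟨L a, LinearMap.mem_range_self L a⟩ = Y a := fun a => by
    simp [φ, LinearMap.quotKerEquivRange_symm_apply_image]
  obtain ⟨g, hg, -⟩ := exists_extension_norm_eq _ <| φ.mkContinuous M <| by
    rintro ⟨-, a, rfl⟩
    rw [hφ]
    exact hYL a
  refine ⟨g, fun i => ?_⟩
  have hLi : L (Finsupp.single i 1) = e i := by simp [hL]
  have hYi : Y (Finsupp.single i 1) = y i := by simp [hY]
  rw [← hLi, ← hYi, ← hφ]
  exact hg ⟨_, LinearMap.mem_range_self L _⟩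

theorem exists_forall_inner_eq [CompleteSpace E] {e : ι → E} {c : ℝ} (hc : 0 < c)
    (hlower : ∀ (F : Finset ι) (a : ι → 𝕜), c * ∑ i ∈ F, ‖a i‖ ^ 2 ≤ ‖∑ i ∈ F, a i • e i‖ ^ 2)
    {y : ι → 𝕜} (hy : Summable fun i => ‖y i‖ ^ 2) : ∃ u : E, ∀ i, inner 𝕜 (e i) u = y i := by
  have hbound : ∀ (F : Finset ι) (a : ι → 𝕜),
      ‖∑ i ∈ F, a i * conj (y i)‖ ≤ √((∑' i, ‖y i‖ ^ 2) / c) * ‖∑ i ∈ F, a i • e i‖ := fun F a => by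
    refine le_of_sq_le_sq ?_ (by positivity)
    rw [mul_pow, Real.sq_sqrt (div_nonneg (tsum_nonneg fun i => sq_nonneg _) hc.le)]
    calc ‖∑ i ∈ F, a i * conj (y i)‖ ^ 2 ≤ (∑ i ∈ F, ‖a i‖ * ‖y i‖) ^ 2 := by
          gcongr
          exact norm_sum_le_of_le F fun i _ => by rw [norm_mul, RCLike.norm_conj]
      _ ≤ (∑ i ∈ F, ‖a i‖ ^ 2) * ∑ i ∈ F, ‖y i‖ ^ 2 := Finset.sum_mul_sq_le_sq_mul_sq ..
      _ ≤ (‖∑ i ∈ F, a i • e i‖ ^ 2 / c) * ∑' i, ‖y i‖ ^ 2 := by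
          gcongr
          · rw [le_div_iff₀' hc]
            exact hlower F a
          · exact hy.sum_le_tsum F fun i _ => sq_nonneg _
      _ = (∑' i, ‖y i‖ ^ 2) / c * ‖∑ i ∈ F, a i • e i‖ ^ 2 := by ring
  obtain ⟨g, hg⟩ := exists_strongDual_apply_eq hbound
  refine ⟨(InnerProductSpace.toDual 𝕜 E).symm g, fun i => ?_⟩
  rw [← inner_conj_symm, InnerProductSpace.toDual_symm_apply, hg, RCLike.conj_conj]

end HilbertSpace

section ExpMoment

variable {ι : Type*}

theorem norm_sq_eq_integral_norm_sq {α E : Type*} [MeasurableSpace α] {μ : Measure α}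
    [NormedAddCommGroup E] (f : Lp E 2 μ) : ‖f‖ ^ 2 = ∫ x, ‖f x‖ ^ 2 ∂μ := by
  have hnonneg : 0 ≤ ∫ x, ‖f x‖ ^ 2 ∂μ := integral_nonneg fun _ => sq_nonneg _
  have hnorm : ‖f‖ = √(∫ x, ‖f x‖ ^ 2 ∂μ) := by
    rw [Lp.norm_def, (Lp.memLp f).eLpNorm_eq_integral_rpow_norm two_ne_zero ENNReal.ofNat_ne_top,
      ENNReal.toReal_ofReal (by positivity), Real.sqrt_eq_rpow]
    simp
  rw [hnorm, Real.sq_sqrt hnonneg]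

/-- The exponential `t ↦ e^{ilt}` as an element of `L²(p, q)`. -/
noncomputable def expMode (p q l : ℝ) : Lp ℂ 2 (volume.restrict (Ioc p q)) :=
  BoundedContinuousFunction.toLp 2 (volume.restrict (Ioc p q)) ℂ
    (BoundedContinuousFunction.ofNormedAddCommGroup
      (fun t : ℝ => Complex.exp ((l * t : ℝ) * Complex.I)) (by fun_prop) 1
      fun t => (Complex.norm_exp_ofReal_mul_I _).le)

theorem coeFn_expMode (p q l : ℝ) :
    expMode p q l =ᵐ[volume.restrict (Ioc p q)] fun t => Complex.exp ((l * t : ℝ) * Complex.I) :=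
  BoundedContinuousFunction.coeFn_toLp ..

theorem norm_sum_smul_expMode_sq {p q : ℝ} (hpq : p ≤ q) (ν : ι → ℝ) (F : Finset ι) (a : ι → ℂ) :
    ‖∑ i ∈ F, a i • expMode p q (ν i)‖ ^ 2 = ∫ t in p..q, ‖expSum ν F a t‖ ^ 2 := by
  have hcoe : ⇑(∑ i ∈ F, a i • expMode p q (ν i)) =ᵐ[volume.restrict (Ioc p q)]
      expSum ν F a := by
    have hterm : ∀ᵐ t ∂volume.restrict (Ioc p q), ∀ i ∈ F, (a i • expMode p q (ν i)) t =
        a i * Complex.exp ((ν i * t : ℝ) * Complex.I) := by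
      refine (Finset.eventually_all F).2 fun i _ => ?_
      filter_upwards [Lp.coeFn_smul (a i) (expMode p q (ν i)), coeFn_expMode p q (ν i)]
        with t hsmul hexp
      rw [hsmul, Pi.smul_apply, hexp, smul_eq_mul]
    filter_upwards [hterm, Lp.coeFn_finsetSum F fun i => a i • expMode p q (ν i)] with t ht hsum
    rw [hsum, Finset.sum_apply, expSum, Finset.sum_congr rfl ht]
  rw [norm_sq_eq_integral_norm_sq, intervalIntegral.integral_of_le hpq]
  exact integral_congr_ae (hcoe.fun_comp fun z => ‖z‖ ^ 2)

theorem inner_expMode {p q : ℝ} (hpq : p ≤ q) (l : ℝ)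
    (v : Lp ℂ 2 (volume.restrict (Ioc p q))) :
    inner ℂ (expMode p q l) v = ∫ t in p..q, Complex.exp ((-(l * t) : ℝ) * Complex.I) * v t := by
  rw [L2.inner_def, intervalIntegral.integral_of_le hpq]
  refine integral_congr_ae ?_
  filter_upwards [coeFn_expMode p q l] with t ht
  rw [ht, RCLike.inner_apply', ← Complex.exp_conj, map_mul, Complex.conj_ofReal, Complex.conj_I]
  push_cast
  ring_nf

/-- The moment `∫ₚ^q e^{-ils} u(s) ds` of a control `u`. -/
noncomputable def expMoment (u : ℝ → ℝ) (p q l : ℝ) : ℂ :=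
  ∫ s in p..q, Complex.exp ((-(l * s) : ℝ) * Complex.I) * u s

theorem IsControl.memLp_restrict_Ioc {T p q : ℝ} {u : ℝ → ℝ} (hu : IsControl T u) (hp : 0 ≤ p)
    (hq : q ≤ T) :
    MemLp u 2 (volume.restrict (Ioc p q)) :=
  hu.mono_measure (Measure.restrict_mono (Ioc_subset_Ioc hp hq) le_rfl)

theorem IsControl.intervalIntegrable {T p q : ℝ} {u : ℝ → ℝ} (hu : IsControl T u) (hp : 0 ≤ p)
    (hpq : p ≤ q) (hq : q ≤ T) : IntervalIntegrable u volume p q := by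
  rw [intervalIntegrable_iff_integrableOn_Ioc_of_le hpq]
  exact (hu.memLp_restrict_Ioc hp hq).integrable one_le_two

theorem sum_norm_expMoment_sq_le {p q C : ℝ} (hpq : p ≤ q) (hC : 0 ≤ C) {ν : ι → ℝ} {F : Finset ι}
    (hupper : ∀ a : ι → ℂ, ∫ t in p..q, ‖expSum ν F a t‖ ^ 2 ≤ C * ∑ i ∈ F, ‖a i‖ ^ 2)
    {u : ℝ → ℝ} (hu : MemLp u 2 (volume.restrict (Ioc p q))) :
    ∑ i ∈ F, ‖expMoment u p q (ν i)‖ ^ 2 ≤ C * ∫ t in p..q, u t ^ 2 := by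
  set v : Lp ℂ 2 (volume.restrict (Ioc p q)) := hu.ofReal.toLp
  have hvu : v =ᵐ[volume.restrict (Ioc p q)] fun t => (u t : ℂ) := hu.ofReal.coeFn_toLp
  have hmoment : ∀ i, expMoment u p q (ν i) = inner ℂ (expMode p q (ν i)) v := fun i => by
    rw [inner_expMode hpq, expMoment, intervalIntegral.integral_of_le hpq,
      intervalIntegral.integral_of_le hpq]
    refine integral_congr_ae ?_
    filter_upwards [hvu] with t ht
    rw [ht]
  have hnorm : ‖v‖ ^ 2 = ∫ t in p..q, u t ^ 2 := by
    rw [norm_sq_eq_integral_norm_sq, intervalIntegral.integral_of_le hpq]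
    refine integral_congr_ae ?_
    filter_upwards [hvu] with t ht
    rw [ht, Complex.norm_real, Real.norm_eq_abs, sq_abs]
  simp only [hmoment, ← hnorm]
  refine sum_norm_inner_sq_le hC (fun a => ?_) v
  rw [norm_sum_smul_expMode_sq hpq]
  exact hupper a

theorem exists_sum_norm_expMoment_sq_le {ν : ι → ℝ} {γ : ℝ} (hγ : 0 < γ)
    (hsep : Pairwise fun i j => γ ≤ |ν i - ν j|) (T : ℝ) :
    ∃ C ≥ 0, ∀ u, IsControl T u → ∀ p q, 0 ≤ p → p ≤ q → q ≤ T → ∀ F : Finset ι,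
      ∑ i ∈ F, ‖expMoment u p q (ν i)‖ ^ 2 ≤ C * ∫ t in p..q, u t ^ 2 := by
  obtain ⟨C, hC, hupper⟩ := exists_integral_expSum_le_mul_sum (s := univ) hγ
    (hsep.set_pairwise univ) (abs_nonneg T)
  refine ⟨C, hC, fun u hu p q hp hpq hq F =>
    sum_norm_expMoment_sq_le hpq hC (fun a => ?_) (hu.memLp_restrict_Ioc hp hq)⟩
  have hT := le_abs_self T
  exact (integral_norm_sq_expSum_mono (by linarith) hpq (by linarith) ν F a).trans
    (hupper F a (subset_univ _))

end ExpMoment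

theorem add_mul_le_of_gap {ω : ℕ → ℝ} {γ : ℝ} (hgap : ∀ k, γ ≤ ω (k + 1) - ω k) (j n : ℕ) :
    ω j + n * γ ≤ ω (j + n) := by
  induction n with
  | zero => simp
  | succ n ih =>
    have hstep := hgap (j + n)
    rw [← add_assoc]
    push_cast
    linarith

theorem add_le_of_gap_of_lt {ω : ℕ → ℝ} {γ : ℝ} (hγ : 0 ≤ γ) (hgap : ∀ k, γ ≤ ω (k + 1) - ω k)
    {j k : ℕ} (hjk : j < k) : ω j + γ ≤ ω k := by
  obtain ⟨n, rfl⟩ := Nat.exists_eq_add_of_lt hjk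
  calc ω j + γ ≤ ω j + (n + 1 : ℕ) * γ := by
        push_cast
        nlinarith [mul_nonneg n.cast_nonneg hγ]
    _ ≤ ω (j + n + 1) := add_mul_le_of_gap hgap j (n + 1)

theorem pairwise_le_abs_sub_of_gap {ω : ℕ → ℝ} {γ : ℝ} (hγ : 0 ≤ γ)
    (hgap : ∀ k, γ ≤ ω (k + 1) - ω k) : Pairwise fun i j => γ ≤ |ω i - ω j| := by
  intro i j hij
  rcases hij.lt_or_gt with h | h
  · have hadd := add_le_of_gap_of_lt hγ hgap h
    rw [abs_sub_comm]
    exact le_abs.2 (.inl (by linarith))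
  · have hadd := add_le_of_gap_of_lt hγ hgap h
    exact le_abs.2 (.inl (by linarith))

/-- The frequencies `ω k` and `-ω k` of the complex modes of the oscillators, in one family. -/
def signedFreq (ω : ℕ → ℝ) : ℕ ⊕ ℕ → ℝ := Sum.elim ω (-ω)

section SignedFreq

variable {ω : ℕ → ℝ} {γ : ℝ}

theorem signedFreq_separated (hω₀ : 0 ≤ ω 0) (hγ : 0 ≤ γ) (hgap : ∀ k, γ ≤ ω (k + 1) - ω k) :
    ({Sum.inr 0}ᶜ : Set (ℕ ⊕ ℕ)).Pairwise fun i j => γ ≤ |signedFreq ω i - signedFreq ω j| := by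
  have hsep := pairwise_le_abs_sub_of_gap hγ hgap
  have hpos : ∀ i j, j ≠ 0 → γ ≤ ω i + ω j := fun i j hj => by
    have hi : ω 0 ≤ ω i := by
      rcases i.eq_zero_or_pos with rfl | hi
      · rfl
      · linarith [add_le_of_gap_of_lt hγ hgap hi]
    linarith [add_le_of_gap_of_lt hγ hgap (Nat.pos_of_ne_zero hj)]
  rintro (i | i) hi (j | j) hj hij
  · exact hsep fun h => hij (congrArg _ h)
  · refine le_abs.2 (.inl ?_)
    simpa [signedFreq] using hpos i j fun h => hj (congrArg _ h)
  · rw [abs_sub_comm]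
    refine le_abs.2 (.inl ?_)
    simpa [signedFreq] using hpos j i fun h => hi (congrArg _ h)
  · have hji := hsep fun h : j = i => hij (congrArg _ h.symm)
    simpa [signedFreq, neg_add_eq_sub] using hji

theorem min_le_abs_signedFreq_sub (hω₀ : 0 ≤ ω 0) (hγ : 0 ≤ γ)
    (hgap : ∀ k, γ ≤ ω (k + 1) - ω k) {i : ℕ ⊕ ℕ} (hi : i ≠ Sum.inr 0) :
    min (ω 0) γ ≤ |signedFreq ω i - signedFreq ω (Sum.inr 0)| := by
  rcases i with i | i
  · refine (min_le_left _ _).trans (le_abs.2 (.inl ?_))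
    rcases i.eq_zero_or_pos with rfl | hpos
    · simpa [signedFreq] using hω₀
    · have hadd := add_le_of_gap_of_lt hγ hgap hpos
      simp only [signedFreq, Sum.elim_inl, Sum.elim_inr, Pi.neg_apply]
      linarith
  · have hsep := pairwise_le_abs_sub_of_gap hγ hgap fun h : 0 = i => hi (congrArg _ h.symm)
    exact (min_le_right _ _).trans (by simpa [signedFreq, neg_add_eq_sub] using hsep)

end SignedFreq

/-- The moment of `re v` at `l` is the average of the moment of `v` at `l` and the conjugate of its
moment at `-l`. -/
theorem expMoment_re_of_conj {v : ℝ → ℂ} {p q l : ℝ} (hv : IntervalIntegrable v volume p q)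
    (hconj : ∫ s in p..q, Complex.exp ((-(-l * s) : ℝ) * Complex.I) * v s =
      conj (∫ s in p..q, Complex.exp ((-(l * s) : ℝ) * Complex.I) * v s)) :
    expMoment (fun s => (v s).re) p q l =
      ∫ s in p..q, Complex.exp ((-(l * s) : ℝ) * Complex.I) * v s := by
  set m := ∫ s in p..q, Complex.exp ((-(l * s) : ℝ) * Complex.I) * v s
  have hcont : ∀ r : ℝ, ContinuousOn (fun s : ℝ => Complex.exp ((-(r * s) : ℝ) * Complex.I))
      (uIcc p q) := fun r => by fun_prop
  have hstar : (∫ s in p..q, conj (Complex.exp ((-(-l * s) : ℝ) * Complex.I) * v s)) = m := by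
    rw [intervalIntegral.intervalIntegral_conj, hconj, Complex.conj_conj]
  calc expMoment (fun s => (v s).re) p q l
      = ∫ s in p..q, (1 / 2 : ℂ) * (Complex.exp ((-(l * s) : ℝ) * Complex.I) * v s +
          conj (Complex.exp ((-(-l * s) : ℝ) * Complex.I) * v s)) := by
        refine intervalIntegral.integral_congr fun s _ => ?_
        have hexp : conj (Complex.exp ((-(-l * s) : ℝ) * Complex.I)) =
            Complex.exp ((-(l * s) : ℝ) * Complex.I) := by
          rw [← Complex.exp_conj, map_mul, Complex.conj_ofReal, Complex.conj_I]
          push_cast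
          ring_nf
        simp only [map_mul, hexp, Complex.re_eq_add_conj]
        ring
    _ = (1 / 2 : ℂ) * (m + m) := by
        rw [intervalIntegral.integral_const_mul, intervalIntegral.integral_add _ _, hstar]
        · exact hv.continuousOn_mul (hcont l)
        · have hint := hv.continuousOn_mul (hcont (-l))
          exact ⟨Complex.conjCLE.toContinuousLinearMap.integrable_comp hint.1,
            Complex.conjCLE.toContinuousLinearMap.integrable_comp hint.2⟩
    _ = m := by ring

theorem exists_expMoment_eq {ω : ℕ → ℝ} {γ T : ℝ} (hω₀ : 0 < ω 0) (hγ : 0 < γ)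
    (hgap : ∀ k, γ ≤ ω (k + 1) - ω k) (hT : 2 * Real.pi / γ < T) {y : ℕ → ℂ}
    (hy : Summable fun k => ‖y k‖ ^ 2) :
    ∃ u, IsControl T u ∧ ∀ k, expMoment u 0 T (ω k) = y k := by
  have hT₀ : 0 ≤ T := (show 0 ≤ 2 * Real.pi / γ by positivity).trans hT.le
  obtain ⟨c, hc, hlower⟩ := exists_mul_sum_le_integral_expSum_zero hγ (lt_min hω₀ hγ)
    (signedFreq_separated hω₀.le hγ.le hgap)
    (fun _ => min_le_abs_signedFreq_sub hω₀.le hγ.le hgap) hT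
  have hsummable : Summable fun i => ‖Sum.elim y (star y) i‖ ^ 2 :=
    .sum _ (by simpa [Function.comp_def] using hy) (by simpa [Function.comp_def] using hy)
  obtain ⟨v, hv⟩ := exists_forall_inner_eq hc (fun F a => by
    rw [norm_sum_smul_expMode_sq hT₀ (signedFreq ω)]
    exact hlower F a) hsummable
  have hpos : ∀ k, ∫ s in 0..T, Complex.exp ((-(ω k * s) : ℝ) * Complex.I) * v s = y k :=
    fun k => (inner_expMode hT₀ (ω k) v).symm.trans (hv (.inl k))
  have hneg : ∀ k, ∫ s in 0..T, Complex.exp ((-(-ω k * s) : ℝ) * Complex.I) * v s = conj (y k) :=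
    fun k => (inner_expMode hT₀ (-ω k) v).symm.trans (hv (.inr k))
  have hvint : IntervalIntegrable v volume 0 T := by
    rw [intervalIntegrable_iff_integrableOn_Ioc_of_le hT₀]
    exact (Lp.memLp v).integrable one_le_two
  exact ⟨fun s => (v s).re, (Lp.memLp v).re,
    fun k => (expMoment_re_of_conj hvint (by rw [hpos, hneg])).trans (hpos k)⟩

/-! ### The controlled oscillators -/

/-- The complex coordinate `ηₖ + i ξₖ` of the `k`-th oscillator. The equations of motion become
`ż = i ωₖ z + bₖ u` in this coordinate. -/
noncomputable def modeCoord (k : ℕ) : State →L[ℝ] ℂ :=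
  Complex.equivRealProdCLM.symm.toContinuousLinearMap ∘L
    ((lp.evalCLM ℝ (fun _ : ℕ => ℝ) 2 k ∘L WithLp.sndL 2 ℝ EllTwo EllTwo).prod
      (lp.evalCLM ℝ (fun _ : ℕ => ℝ) 2 k ∘L WithLp.fstL 2 ℝ EllTwo EllTwo))

@[simp] theorem modeCoord_re (k : ℕ) (x : State) : (modeCoord k x).re = x.snd k := rfl

@[simp] theorem modeCoord_im (k : ℕ) (x : State) : (modeCoord k x).im = x.fst k := rfl

theorem ext_modeCoord {x y : State} (h : ∀ k, modeCoord k x = modeCoord k y) : x = y :=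
  state_ext fun k => ⟨congrArg Complex.im (h k), congrArg Complex.re (h k)⟩

theorem hasSum_inner (x y : State) :
    HasSum (fun k => x.fst k * y.fst k + x.snd k * y.snd k) (inner ℝ x y) := by
  rw [WithLp.prod_inner_apply]
  refine ((lp.hasSum_inner x.fst y.fst).add (lp.hasSum_inner x.snd y.snd)).congr_fun fun k => ?_
  simp [mul_comm]

theorem norm_modeCoord_sq (k : ℕ) (x : State) :
    ‖modeCoord k x‖ ^ 2 = x.fst k ^ 2 + x.snd k ^ 2 := by
  rw [Complex.sq_norm, Complex.normSq_apply, modeCoord_re, modeCoord_im]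
  ring

theorem hasSum_norm_modeCoord_sq (x : State) :
    HasSum (fun k => ‖modeCoord k x‖ ^ 2) (‖x‖ ^ 2) := by
  simpa only [norm_modeCoord_sq, ← sq, real_inner_self_eq_norm_sq] using hasSum_inner x x

theorem exists_modeCoord_eq {z : ℕ → ℂ} (hz : Summable fun k => ‖z k‖ ^ 2) :
    ∃ x : State, ∀ k, modeCoord k x = z k :=
  ⟨WithLp.toLp 2
    (⟨fun k => (z k).im, memℓp_two_of_sq_le hz fun k => sq_le_sq.2 <| by
        simpa using Complex.abs_im_le_norm (z k)⟩,
      ⟨fun k => (z k).re, memℓp_two_of_sq_le hz fun k => sq_le_sq.2 <| by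
        simpa using Complex.abs_re_le_norm (z k)⟩), fun _ => rfl⟩

/-- The operator multiplying the `k`-th coordinates `ξₖ`, `ηₖ` by `bₖ`. It maps `H` isometrically
onto `V_{0,1}`. -/
noncomputable def scale (b : EllTwo) : State →L[ℝ] State :=
  let mulCLM : EllTwo →L[ℝ] EllTwo := lp.mapCLM 2 (fun k => b k • ContinuousLinearMap.id ℝ ℝ)
    (norm_nonneg b) fun k => by
      simpa [norm_smul] using lp.norm_apply_le_norm two_ne_zero b k
  (WithLp.prodContinuousLinearEquiv 2 ℝ EllTwo EllTwo).symm.toContinuousLinearMap ∘L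
    mulCLM.prodMap mulCLM ∘L
      (WithLp.prodContinuousLinearEquiv 2 ℝ EllTwo EllTwo).toContinuousLinearMap

@[simp] theorem scale_fst (b : EllTwo) (x : State) (k : ℕ) :
    (scale b x).fst k = b k * x.fst k := rfl

@[simp] theorem scale_snd (b : EllTwo) (x : State) (k : ℕ) :
    (scale b x).snd k = b k * x.snd k := rfl

theorem modeCoord_scale (b : EllTwo) (k : ℕ) (x : State) :
    modeCoord k (scale b x) = b k * modeCoord k x := by
  apply Complex.ext <;> simp

section Scale

variable {b : EllTwo} (hb : ∀ k, b k ≠ 0)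
include hb

theorem scale_injective : Function.Injective (scale b) := fun x y hxy =>
  ext_modeCoord fun k => mul_left_cancel₀ (Complex.ofReal_ne_zero.2 (hb k)) <| by
    rw [← modeCoord_scale, ← modeCoord_scale, hxy]

theorem range_scale : range (scale b) = V b := by
  ext x
  constructor
  · rintro ⟨y, rfl⟩
    refine (hasSum_norm_modeCoord_sq y).summable.congr fun k => ?_
    have hbk := hb k
    rw [norm_modeCoord_sq, scale_fst, scale_snd, sq_abs]
    field_simp
  · intro hx
    have hsummable : Summable fun k => ‖modeCoord k x / b k‖ ^ 2 := by
      refine Summable.congr hx fun k => ?_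
      rw [norm_div, div_pow, norm_modeCoord_sq, Complex.norm_real, Real.norm_eq_abs]
    obtain ⟨y, hy⟩ := exists_modeCoord_eq hsummable
    refine ⟨y, ext_modeCoord fun k => ?_⟩
    rw [modeCoord_scale, hy, mul_div_cancel₀ _ (Complex.ofReal_ne_zero.2 (hb k))]

theorem vInner_scale (x y : State) : vInner b (scale b x) (scale b y) = inner ℝ x y := by
  rw [← (hasSum_inner x y).tsum_eq, vInner]
  refine tsum_congr fun k => ?_
  have hbk := hb k
  rw [scale_fst, scale_fst, scale_snd, scale_snd, sq_abs]
  field_simp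

theorem vNorm_scale (x : State) : vNorm b (scale b x) = ‖x‖ := by
  rw [vNorm, vInner_scale hb, real_inner_self_eq_norm_sq, Real.sqrt_sq (norm_nonneg x)]

theorem isHilbertSubspaceWith_V : IsHilbertSubspaceWith (V b) (vInner b) :=
  ⟨State, inferInstance, inferInstance, inferInstance, scale b, scale_injective hb,
    range_scale hb, fun x y => (vInner_scale hb x y).symm⟩

end Scale

theorem modeCoord_flow (ω : ℕ → ℝ) (t : ℝ) (k : ℕ) (x : State) :
    modeCoord k (flow ω t x) = Complex.exp ((ω k * t : ℝ) * Complex.I) * modeCoord k x := by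
  apply Complex.ext
  · rw [Complex.mul_re, Complex.exp_ofReal_mul_I_re, Complex.exp_ofReal_mul_I_im, modeCoord_re,
      modeCoord_re, modeCoord_im, flow_snd]
    ring
  · rw [Complex.mul_im, Complex.exp_ofReal_mul_I_re, Complex.exp_ofReal_mul_I_im, modeCoord_im,
      modeCoord_re, modeCoord_im, flow_fst]

theorem flow_sub_state (ω : ℕ → ℝ) (t : ℝ) (x y : State) :
    flow ω t (x - y) = flow ω t x - flow ω t y :=
  ext_modeCoord fun k => by simp only [modeCoord_flow, map_sub, mul_sub]

theorem norm_flow (ω : ℕ → ℝ) (t : ℝ) (x : State) : ‖flow ω t x‖ = ‖x‖ := by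
  have hsq : ‖flow ω t x‖ ^ 2 = ‖x‖ ^ 2 := by
    refine (hasSum_norm_modeCoord_sq _).unique ((hasSum_norm_modeCoord_sq x).congr_fun fun k => ?_)
    rw [modeCoord_flow, norm_mul, Complex.norm_exp_ofReal_mul_I, one_mul]
  exact (sq_eq_sq₀ (norm_nonneg _) (norm_nonneg x)).1 hsq

theorem flow_flow_neg (ω : ℕ → ℝ) (t : ℝ) (x : State) : flow ω t (flow ω (-t) x) = x := by
  rw [← flow_add, add_neg_cancel, flow_zero]

theorem continuous_flow_uncurry (ω : ℕ → ℝ) :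
    Continuous fun p : ℝ × State => flow ω p.1 p.2 :=
  continuous_prod_of_continuous_lipschitzWith' _ 1
    (fun t => LipschitzWith.of_dist_le_mul fun x y => by
      simp only [dist_eq_norm, ← flow_sub_state, norm_flow, NNReal.coe_one, one_mul, le_refl])
    (continuous_flow ω)

theorem modeCoord_ctrl (b : EllTwo) (k : ℕ) : modeCoord k (ctrl b) = b k := by
  apply Complex.ext <;> simp [ctrl]

section Solution

variable {ω : ℕ → ℝ} {b : EllTwo} {T t : ℝ} {u : ℝ → ℝ}

theorem modeCoord_integral_ctrl (hu : IsControl T u) (ht : t ∈ Icc 0 T) (k : ℕ) :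
    modeCoord k (∫ s in (0 : ℝ)..t, u s • flow ω (t - s) (ctrl b)) =
      b k * (Complex.exp ((ω k * t : ℝ) * Complex.I) * expMoment u 0 t (ω k)) := by
  have hint : IntervalIntegrable (fun s => u s • flow ω (t - s) (ctrl b)) volume 0 t :=
    (hu.intervalIntegrable le_rfl ht.1 ht.2).smul_continuousOn
      ((continuous_flow ω (ctrl b)).comp (continuous_const.sub continuous_id)).continuousOn
  rw [← (modeCoord k).intervalIntegral_comp_comm hint, expMoment, ← mul_assoc,
    ← intervalIntegral.integral_const_mul]
  refine intervalIntegral.integral_congr fun s _ => ?_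
  have hexp : Complex.exp ((ω k * (t - s) : ℝ) * Complex.I) =
      Complex.exp ((ω k * t : ℝ) * Complex.I) * Complex.exp ((-(ω k * s) : ℝ) * Complex.I) := by
    rw [← Complex.exp_add]
    push_cast
    ring_nf
  simp only [map_smul, modeCoord_flow, modeCoord_ctrl, hexp, Complex.real_smul]
  ring

theorem solution_scale (hu : IsControl T u) (ht : t ∈ Icc 0 T) {m : State}
    (hm : ∀ k, modeCoord k m = expMoment u 0 t (ω k)) (y : State) :
    solution ω b (scale b y) u t = scale b (flow ω t (y + m)) :=
  ext_modeCoord fun k => by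
    simp only [solution, map_add, modeCoord_integral_ctrl hu ht, modeCoord_flow, modeCoord_scale,
      hm]
    ring

end Solution

theorem exactlyControllableIn_V {b : EllTwo} (hb : ∀ k, b k ≠ 0) {ω : ℕ → ℝ} {γ T : ℝ}
    (hω₀ : 0 < ω 0) (hγ : 0 < γ) (hgap : ∀ k, γ ≤ ω (k + 1) - ω k) (hT : 2 * Real.pi / γ < T) :
    ExactlyControllableIn ω b T (V b) := by
  have hT₀ : 0 ≤ T := (show 0 ≤ 2 * Real.pi / γ by positivity).trans hT.le
  intro x₀ hx₀ x₁ hx₁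
  obtain ⟨y₀, rfl⟩ : x₀ ∈ range (scale b) := by rwa [range_scale hb]
  obtain ⟨y₁, rfl⟩ : x₁ ∈ range (scale b) := by rwa [range_scale hb]
  obtain ⟨u, hu, hmoment⟩ := exists_expMoment_eq hω₀ hγ hgap hT
    (hasSum_norm_modeCoord_sq (flow ω (-T) y₁ - y₀)).summable
  refine ⟨u, hu, ?_⟩
  rw [solution_scale hu ⟨hT₀, le_rfl⟩ (fun k => (hmoment k).symm), add_sub_cancel, flow_flow_neg]

theorem continuousOn_of_norm_sub_sq_le {E : Type*} [NormedAddCommGroup E] {m : ℝ → E}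
    {f : ℝ → ℝ} {p q C : ℝ} (hf : IntervalIntegrable f volume p q)
    (hm : ∀ s t, p ≤ s → s ≤ t → t ≤ q → ‖m t - m s‖ ^ 2 ≤ C * ∫ r in s..t, f r) :
    ContinuousOn m (Icc p q) := by
  intro t ht
  have hlim : Tendsto (fun s => |C * ∫ r in t..s, f r|) (𝓝[Icc p q] t) (𝓝 0) := by
    have hcont := intervalIntegral.continuousOn_primitive_interval' hf (Icc_subset_uIcc ht)
    simpa using ((((hcont t (Icc_subset_uIcc ht)).mono Icc_subset_uIcc).tendsto).const_mul C).abs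
  have hbound : ∀ s ∈ Icc p q, ‖m s - m t‖ ^ 2 ≤ |C * ∫ r in t..s, f r| := by
    intro s hs
    rcases le_total s t with h | h
    · rw [norm_sub_rev, intervalIntegral.integral_symm, mul_neg, abs_neg]
      exact (hm s t hs.1 h ht.2).trans (le_abs_self _)
    · exact (hm t s ht.1 h hs.2).trans (le_abs_self _)
  rw [ContinuousWithinAt, tendsto_iff_norm_sub_tendsto_zero]
  have hsq : Tendsto (fun s => ‖m s - m t‖ ^ 2) (𝓝[Icc p q] t) (𝓝 0) :=
    squeeze_zero' (Eventually.of_forall fun s => sq_nonneg _)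
      (eventually_nhdsWithin_of_forall hbound) hlim
  simpa using hsq.sqrt

theorem expMoment_sub_expMoment {T s t : ℝ} {u : ℝ → ℝ} (hu : IsControl T u) (hs : 0 ≤ s)
    (hst : s ≤ t) (ht : t ≤ T) (l : ℝ) :
    expMoment u 0 t l - expMoment u 0 s l = expMoment u s t l := by
  have hint : ∀ r, 0 ≤ r → r ≤ T → IntervalIntegrable
      (fun x => Complex.exp ((-(l * x) : ℝ) * Complex.I) * u x) volume 0 r := fun r hr hrT =>
    IntervalIntegrable.continuousOn_mul
      ⟨(hu.intervalIntegrable le_rfl hr hrT).1.ofReal,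
        (hu.intervalIntegrable le_rfl hr hrT).2.ofReal⟩
      (by fun_prop)
  exact intervalIntegral.integral_interval_sub_left (hint t (hs.trans hst) ht)
    (hint s hs (hst.trans ht))

theorem exists_momentPath {ω : ℕ → ℝ} {γ : ℝ} (hγ : 0 < γ)
    (hsep : Pairwise fun i j => γ ≤ |ω i - ω j|) (τ : ℝ) :
    ∃ C ≥ 0, ∀ u, IsControl τ u → ∃ m : ℝ → State,
      (∀ t ∈ Icc 0 τ, ∀ k, modeCoord k (m t) = expMoment u 0 t (ω k)) ∧
      ∀ s t, 0 ≤ s → s ≤ t → t ≤ τ → ‖m t - m s‖ ^ 2 ≤ C * ∫ r in s..t, u r ^ 2 := by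
  obtain ⟨C, hC, hbessel⟩ := exists_sum_norm_expMoment_sq_le hγ hsep τ
  refine ⟨C, hC, fun u hu => ?_⟩
  have hsummable : ∀ t ∈ Icc 0 τ, Summable fun k => ‖expMoment u 0 t (ω k)‖ ^ 2 := fun t ht =>
    summable_of_sum_le (fun _ => sq_nonneg _) (hbessel u hu 0 t le_rfl ht.1 ht.2)
  choose! m hm using fun t ht => exists_modeCoord_eq (hsummable t ht)
  refine ⟨m, hm, fun s t hs hst ht => ?_⟩
  refine (hasSum_norm_modeCoord_sq _).tsum_eq.symm.trans_le
    ((hasSum_norm_modeCoord_sq _).summable.tsum_le_of_sum_le fun F => ?_)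
  have hdiff : ∀ k, modeCoord k (m t - m s) = expMoment u s t (ω k) := fun k => by
    rw [map_sub, hm t ⟨hs.trans hst, ht⟩, hm s ⟨hs, hst.trans ht⟩,
      expMoment_sub_expMoment hu hs hst ht]
  simpa only [hdiff] using hbessel u hu s t hs hst ht F

theorem IsControl.intervalIntegrable_sq {T : ℝ} {u : ℝ → ℝ} (hu : IsControl T u) (hT : 0 ≤ T) :
    IntervalIntegrable (fun t => u t ^ 2) volume 0 T := by
  rw [intervalIntegrable_iff_integrableOn_Ioc_of_le hT]
  exact MemLp.integrable_sq hu

theorem exists_solution_eq_scale (b : EllTwo) {ω : ℕ → ℝ} {γ : ℝ} (hγ : 0 < γ)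
    (hsep : Pairwise fun i j => γ ≤ |ω i - ω j|) {τ : ℝ} (hτ : 0 ≤ τ) :
    ∃ C ≥ 0, ∀ u, IsControl τ u → ∀ y, ∃ z : ℝ → State, ContinuousOn z (Icc 0 τ) ∧
      (∀ t ∈ Icc 0 τ, solution ω b (scale b y) u t = scale b (z t)) ∧
      ∀ t ∈ Icc 0 τ, ‖z t‖ ≤ ‖y‖ + C * √(∫ s in (0 : ℝ)..τ, u s ^ 2) := by
  obtain ⟨C, hC, hpath⟩ := exists_momentPath hγ hsep τ
  refine ⟨√C, Real.sqrt_nonneg C, fun u hu y => ?_⟩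
  obtain ⟨m, hm, hsub⟩ := hpath u hu
  refine ⟨fun t => flow ω t (y + m t), ?_, fun t ht => solution_scale hu ht (hm t ht) y,
    fun t ht => ?_⟩
  · have hm_cont : ContinuousOn m (Icc 0 τ) :=
      continuousOn_of_norm_sub_sq_le (hu.intervalIntegrable_sq hτ) hsub
    exact (continuous_flow_uncurry ω).comp_continuousOn
      (f := fun t => (t, y + m t)) (by fun_prop)
  · have hm₀ : m 0 = 0 := ext_modeCoord fun k => by
      rw [hm 0 ⟨le_rfl, ht.1.trans ht.2⟩, expMoment, intervalIntegral.integral_same, map_zero]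
    have hmono : ∫ s in (0 : ℝ)..t, u s ^ 2 ≤ ∫ s in (0 : ℝ)..τ, u s ^ 2 :=
      intervalIntegral.integral_mono_interval le_rfl ht.1 ht.2
        (Eventually.of_forall fun s => sq_nonneg _) (hu.intervalIntegrable_sq hτ)
    have hmt : ‖m t‖ ≤ √C * √(∫ s in (0 : ℝ)..τ, u s ^ 2) := by
      rw [← Real.sqrt_mul hC]
      refine Real.le_sqrt_of_sq_le ?_
      calc ‖m t‖ ^ 2 ≤ C * ∫ s in (0 : ℝ)..t, u s ^ 2 := by
            simpa only [hm₀, sub_zero] using hsub 0 t le_rfl ht.1 ht.2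
        _ ≤ C * ∫ s in (0 : ℝ)..τ, u s ^ 2 := by gcongr
    calc ‖flow ω t (y + m t)‖ = ‖y + m t‖ := norm_flow ω t _
      _ ≤ ‖y‖ + √C * √(∫ s in (0 : ℝ)..τ, u s ^ 2) := norm_add_le_of_le le_rfl hmt

theorem wellPosedInV {b : EllTwo} (hb : ∀ k, b k ≠ 0) {ω : ℕ → ℝ} {γ : ℝ} (hγ : 0 < γ)
    (hsep : Pairwise fun i j => γ ≤ |ω i - ω j|) : WellPosedInV ω b := by
  intro τ hτ
  obtain ⟨C, hC, hsol⟩ := exists_solution_eq_scale b hγ hsep hτ.le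
  refine ⟨1 + C, fun x₀ hx₀ u hu => ?_⟩
  obtain ⟨y, rfl⟩ : x₀ ∈ range (scale b) := by rwa [range_scale hb]
  obtain ⟨z, hz, heq, hbound⟩ := hsol u hu y
  refine ⟨fun t ht => ?_, fun t ht => ?_, fun t ht => ?_⟩
  · rw [heq t ht, ← SetLike.mem_coe, ← range_scale hb]
    exact mem_range_self _
  · refine (tendsto_iff_norm_sub_tendsto_zero.1 (hz t ht)).congr' ?_
    filter_upwards [self_mem_nhdsWithin] with s hs
    rw [heq s hs, heq t ht, ← map_sub, vNorm_scale hb]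
  · rw [heq t ht, vNorm_scale hb, vNorm_scale hb]
    nlinarith [hbound t ht, mul_nonneg hC (norm_nonneg y),
      Real.sqrt_nonneg (∫ s in (0 : ℝ)..τ, u s ^ 2)]

theorem WellPosedInV.reachable_subset {ω : ℕ → ℝ} {b : EllTwo} (h : WellPosedInV ω b) {T : ℝ}
    (hT : 0 < T) {x₀ : State} (hx₀ : x₀ ∈ V b) : reachable ω b T x₀ ⊆ V b := by
  rintro _ ⟨u, hu, rfl⟩
  obtain ⟨_, hC⟩ := h T hT
  exact (hC x₀ hx₀ u hu).1 T ⟨hT.le, le_rfl⟩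

theorem ExactlyControllableIn.subset_reachable {ω : ℕ → ℝ} {b : EllTwo} {T : ℝ}
    {W : Submodule ℝ State} (h : ExactlyControllableIn ω b T W) {x₀ : State} (hx₀ : x₀ ∈ W) :
    (W : Set State) ⊆ reachable ω b T x₀ :=
  h x₀ hx₀

end Oscillator

open Oscillator in
theorem mainTheorem5_general {b : EllTwo} {ω : ℕ → ℝ} {γ T : ℝ} (hb : ∀ k, b k ≠ 0)
    (hω₀ : 0 < ω 0) (hγ : 0 < γ) (hgap : ∀ k, γ ≤ ω (k + 1) - ω k) (hT : 2 * Real.pi / γ < T) :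
    IsHilbertSubspaceWith (V b) (vInner b) ∧
    ExactlyControllableIn ω b T (V b) ∧
    (∀ x₀ ∈ V b, reachable ω b T x₀ = (V b : Set State)) ∧
    IsGreatest {W : Submodule ℝ State | ExactlyControllableIn ω b T W} (V b) ∧
    WellPosedInV ω b := by
  have hT₀ : 0 < T := (show 0 ≤ 2 * Real.pi / γ by positivity).trans_lt hT
  have hcontrol := exactlyControllableIn_V hb hω₀ hγ hgap hT
  have hposed := wellPosedInV hb hγ (pairwise_le_abs_sub_of_gap hγ.le hgap)
  refine ⟨isHilbertSubspaceWith_V hb, hcontrol, fun x₀ hx₀ => ?_, ⟨hcontrol, fun W hW => ?_⟩,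
    hposed⟩
  · exact (hposed.reachable_subset hT₀ hx₀).antisymm (hcontrol.subset_reachable hx₀)
  · exact (hW.subset_reachable W.zero_mem).trans (hposed.reachable_subset hT₀ (V b).zero_mem)

theorem mainTheorem5 (b : Oscillator.EllTwo) (ω : ℕ → ℝ) (ωstar T : ℝ)
    (hb : ∀ k, b k ≠ 0)
    (hω₀ : 0 < ω 0) (hωstar : 0 < ωstar) (hgap : ∀ k, ωstar ≤ ω (k + 1) - ω k)
    (hT : 2 * Real.pi / ωstar < T) :
    Oscillator.IsHilbertSubspaceWith (Oscillator.V b) (Oscillator.vInner b) ∧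
    Oscillator.ExactlyControllableIn ω b T (Oscillator.V b) ∧
    (∀ x₀ ∈ Oscillator.V b, Oscillator.reachable ω b T x₀ = (Oscillator.V b : Set Oscillator.State)) ∧
    IsGreatest {W : Submodule ℝ Oscillator.State |
      Oscillator.IsHilbertSubspace W ∧ Oscillator.ExactlyControllableIn ω b T W}
      (Oscillator.V b) ∧
    Oscillator.WellPosedInV ω b := by
  obtain ⟨hV, hcontrol, hreach, hmax, hposed⟩ :=
    mainTheorem5_general hb hω₀ hωstar hgap hT
  exact ⟨hV, hcontrol, hreach, ⟨⟨⟨_, hV⟩, hcontrol⟩, fun W hW => hmax.2 hW.2⟩, hposed⟩
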